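/- **Setting.** Let $[n]=\{0,\dots,n\}$, let $X$ be a simplicial complex on $[n]$ (a set of subsets of $[n]$ closed under passing to subsets), $P=\mathbb C[x_0,\dots,x_n]$, $x^p=\prod_{i\in p}x_i$ for $p\subseteq[n]$, $I=\langle x^p\mid p\notin X\rangle$ and $A=P/I$ the Stanley–Reisner ring. Let $j:P^m\to P$, $e_p\mapsto x^p$, where $m$ is the number of non-faces $p$, let $R=\ker j$, and let $R_0\subseteq R$ be generated by the Koszul relations $j(v)u-j(u)v$ with $u,v\in P^m$. Put $$T^1=\operatorname{coker}(\operatorname{Der}_{\mathbb C}(P,P)\to\operatorname{Hom}_P(I,A)),\qquad T^2=\operatorname{coker}(\operatorname{Hom}_P(P^m,A)\to\operatorname{Hom}_A(R/R_0,A)).$$ These modules are $\mathbb Z^{n+1}$-graded, with $\deg e_p=p$ (a subset being identified with its characteristic vector). The cup product $\cup:T^1\times T^1\to T^2$ is defined by $$(\varphi\cup\psi)(r)=\psi\Big(\sum_p r_p\widetilde\varphi_p\Big)+\varphi\Big(\sum_p r_p\widetilde\psi_p\Big)\qquad(r\in R),$$ where $\widetilde\varphi_p,\widetilde\psi_p\in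 P$ are any lifts of $\varphi(x^p),\psi(x^p)\in A$. For $\mathbf c\in\mathbb Z^{n+1}$ write $\mathbf c=\mathbf a-\mathbf b$ with $\mathbf a,\mathbf b\in\mathbb N^{n+1}$ of disjoint supports $a,b$. Put $$N_{a-b}=\{f\in X\mid a\subseteq f,\ f\cap b=\emptyset,\ f\cup b\notin X\},\qquad \widetilde N_{a-b}=\{f\in N_{a-b}\mid f\cup b'\notin X\text{ for some } b'\subsetneq b\},$$ $$N^{(2)}_{a-b}=\{(f,g)\in N_{a-b}^2\mid f\cup g\in X\}.$$ Assume $\mathbf b\in\{0,1\}^{n+1}$. A function $\varphi:N_{a-b}\to\mathbb C$ with $\varphi=0$ on $\widetilde N_{a-b}$ and $\varphi(f)=\varphi(g)$ whenever $f\cup g\in X$ *describes* a class in $T^1_{\mathbf c}$ if this class is represented by a homomorphism of degree $\mathbf c$ with $x^p\mapsto\varphi((p\cup a)\setminus b)\,x^{p+\mathbf c}$ for all $p\notin X$. A function $\lambda:N^{(2)}_{a-b}\to\mathbb C$ that is antisymmetric, vanishes on pairs in $\widetilde N_{a-b}$ and satisfies $\lambda(f,g)-\lambda(f,h)+\lambda(g,h)=0$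 whenever $f,g,h\in N_{a-b}$ and $f\cup g\cup h\in X$ *describes* a class in $T^2_{\mathbf c}$ if this class is represented by a homomorphism of degree $\mathbf c$ with $$R_{p,q}:=x^{q\setminus p}e_p-x^{p\setminus q}e_q\ \mapsto\ \lambda((p\cup a)\setminus b,(q\cup a)\setminus b)\,x^{(p\cup q)+\mathbf c}\qquad\text{for all }p,q\notin X.$$ Here a term $\lambda(\dots)\,x^{\mathbf e}$ is read as $0$ if $\mathbf e$ has a negative entry or if $x^{\mathbf e}=0$ in $A$. **Proposition.** Let $\mathbf c^1=\mathbf a^1-\mathbf b^1$, $\mathbf c^2=\mathbf a^2-\mathbf b^2\in\mathbb Z^{n+1}$ be decomposed in this way, with supports $a^i,b^i$, and let $\mathbf c^1+\mathbf c^2=\mathbf a-\mathbf b$ be the decomposition of the sum, with supports $a,b$. The cup product restricts to $\cup:T^1_{\mathbf a^1-\mathbf b^1}\times T^1_{\mathbf a^2-\mathbf b^2}\to T^2_{\mathbf a-\mathbf b}$, and this map is determined by the following. (i) If $b^1\cap b^2\neq\emptyset$, then $\cup=0$. Also $\cup=0$ if $\mathbf b^1\notin\{0,1\}^{n+1}$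 or $\mathbf b^2\notin\{0,1\}^{n+1}$. Now assume $\mathbf b^1,\mathbf b^2\in\{0,1\}^{n+1}$ and $b^1\cap b^2=\emptyset$. (ii) Then $\mathbf b\in\{0,1\}^{n+1}$ and $$b=(b^1\setminus a^2)\cup(b^2\setminus a^1),\qquad a=(a^1\setminus b^2)\cup(a^2\setminus b^1)\cup(a^1_{\ge2}\cup a^2_{\ge2}),$$ where $a^i_{\geq 2}=\{v\in[n]\mid \mathbf a^i_v\ge2\}$. (iii) Every class in $T^1_{\mathbf a^i-\mathbf b^i}$ ($i=1,2$) is described by a function on $N_{a^i-b^i}$. For each $f\in N_{a-b}$ choose a maximal subset $d_f\subseteq b$ such that $f\cup(b\setminus d_f)\notin X$. If $\varphi$ and $\psi$ describe classes in $T^1_{\mathbf a^1-\mathbf b^1}$ and $T^1_{\mathbf a^2-\mathbf b^2}$, then the cup product of these classes is described by the function on $N^{(2)}_{a-b}$ whose value at $(f,g)$ is, with $d=d_f$ and $e=d_g$, $$\big[\varphi((f\setminus b^1)\cup(b^2\setminus d))-\varphi((g\setminus b^1)\cup(b^2\setminus e))\big]\cdot\psi((f\cup g\cup a^2)\setminus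 b^2)$$ $$+\big[\psi((f\setminus b^2)\cup(b^1\setminus d))-\psi((g\setminus b^2)\cup(b^1\setminus e))\big]\cdot\varphi((f\cup g\cup a^1)\setminus b^1).$$ Here $\varphi,\psi$ are defined to be zero on non-elements of $X$, and may be extended arbitrarily to $X\setminus N_{a^1-b^1}$ and $X\setminus N_{a^2-b^2}$, respectively. -/

import Mathlib

/-! ## The modules `T¹`, `T²` and the cup product of a presented algebra

`P` is a commutative `k`-algebra, `f : σ → P` a finite family of elements, `I` the ideal it generates and
`A = P/I`. When `P` is a polynomial ring over `k`, the objects below are the usual `T¹_A`, `T²_A`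
and the cup product `T¹_A × T¹_A → T²_A`. -/

namespace Cotangent

noncomputable section Modules

variable (k : Type*) {P σ : Type*} [CommRing k] [CommRing P] [Algebra k P] (f : σ → P)

/-- The ideal `I` generated by the family `f`. -/
abbrev ideal : Ideal P := Ideal.span (Set.range f)

/-- The algebra `A = P/I`. -/
abbrev Alg : Type _ := P ⧸ ideal f

/-- The generator `f s`, as an element of `I`. -/
def gen (s : σ) : ideal f := ⟨f s, Ideal.subset_span ⟨s, rfl⟩⟩

/-- The natural map `Der_k(P, P) → Hom_P(I, A)`, which sends `D` to `u ↦ [D u]`. -/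
def derToHom : Derivation k P P →ₗ[P] (ideal f →ₗ[P] Alg f) where
  toFun D :=
    { toFun := fun u => Ideal.Quotient.mk (ideal f) (D (u : P))
      map_add' := fun u v => by simp
      map_smul' := fun a u => by
        have h : (Ideal.Quotient.mk (ideal f)) (u : P) = 0 :=
          Ideal.Quotient.eq_zero_iff_mem.mpr u.2
        simp [h, Algebra.smul_def] }
  map_add' D E := by ext u; simp
  map_smul' a D := by ext u; simp [Algebra.smul_def]

/-- `T¹_A`, the cokernel of `Der_k(P, P) → Hom_P(I, A)`. -/
abbrev T1 : Type _ := (ideal f →ₗ[P] Alg f) ⧸ LinearMap.range (derToHom k f)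

/-- `t : σ → P` is a lift of `φ ∈ Hom_P(I, A)`: the class of `t s` in `A` is `φ (f s)`. -/
def IsLift (φ : ideal f →ₗ[P] Alg f) (t : σ → P) : Prop :=
  ∀ s, Ideal.Quotient.mk (ideal f) (t s) = φ (gen f s)

theorem exists_isLift {f : σ → P} (φ : ideal f →ₗ[P] Alg f) : ∃ t, IsLift f φ t :=
  ⟨fun s => (Ideal.Quotient.mk_surjective (φ (gen f s))).choose,
    fun s => (Ideal.Quotient.mk_surjective (φ (gen f s))).choose_spec⟩

theorem smul_eq_zero_of_mem {a : P} (ha : a ∈ ideal f) (y : Alg f) : a • y = 0 := by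
  rw [Algebra.smul_def, Ideal.Quotient.algebraMap_eq, Ideal.Quotient.eq_zero_iff_mem.mpr ha,
    zero_mul]

variable [Fintype σ]

/-- The map `j : P^σ → P` that sends the basis vector `e_s` to `f s`. -/
abbrev pres : (σ → P) →ₗ[P] P := Fintype.linearCombination P f

/-- The module `R` of relations among the `f s`. -/
abbrev Rel : Submodule P (σ → P) := LinearMap.ker (pres f)

/-- The submodule `R₀ ⊆ R` generated by the Koszul relations `j(v) u - j(u) v`. -/
def koszul : Submodule P (Rel f) :=
  Submodule.span P {r | ∃ u v : σ → P, (r : σ → P) = pres f v • u - pres f u • v}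

/-- The space `Hom_A(R/R₀, A)`. Since `P → A` is onto, `A`-linear maps between the two `A`-modules
are the same as `P`-linear ones. -/
abbrev RelHom : Type _ := (Rel f ⧸ koszul f) →ₗ[P] Alg f

theorem pres_mem (u : σ → P) : pres f u ∈ ideal f := by
  rw [Fintype.linearCombination_apply]
  exact Ideal.sum_mem _ fun s _ => Ideal.mul_mem_left _ _ (gen f s).2

theorem koszul_le_ker {g : Rel f →ₗ[P] Alg f}
    (hg : ∀ (u v : σ → P) (r : Rel f), (r : σ → P) = pres f v • u - pres f u • v → g r = 0) :
    koszul f ≤ LinearMap.ker g := by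
  rw [koszul, Submodule.span_le]
  rintro r ⟨u, v, h⟩
  exact hg u v r h

/-- The map `Hom_P(P^σ, A) → Hom_A(R/R₀, A)` given by restriction to `R`. -/
def restrictHom : ((σ → P) →ₗ[P] Alg f) →ₗ[P] RelHom f where
  toFun g := (koszul f).liftQ (g ∘ₗ (Rel f).subtype) (koszul_le_ker f (by
    intro u v r h
    simp only [LinearMap.coe_comp, Function.comp_apply, Submodule.subtype_apply, h, map_sub,
      map_smul]
    rw [smul_eq_zero_of_mem f (pres_mem f v), smul_eq_zero_of_mem f (pres_mem f u), sub_zero]))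
  map_add' g h := by ext r; simp
  map_smul' a g := by ext r; simp

/-- `T²_A`, the cokernel of `Hom_P(P^σ, A) → Hom_A(R/R₀, A)`. -/
abbrev T2 : Type _ := RelHom f ⧸ LinearMap.range (restrictHom f)

variable {f}

theorem IsLift.mk_eq {φ : ideal f →ₗ[P] Alg f} {t : σ → P} (ht : IsLift f φ t) (u : σ → P) :
    Ideal.Quotient.mk (ideal f) (Fintype.linearCombination P t u)
      = φ ⟨pres f u, pres_mem f u⟩ := by
  have h : (⟨pres f u, pres_mem f u⟩ : ideal f) = Fintype.linearCombination P (gen f) u := by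
    apply Subtype.ext
    simp [Fintype.linearCombination_apply, gen]
  rw [h]
  simp only [Fintype.linearCombination_apply, map_sum, map_smul, smul_eq_mul,
    map_mul]
  refine Finset.sum_congr rfl fun s _ => ?_
  rw [ht s, Algebra.smul_def, Ideal.Quotient.algebraMap_eq]

/-- For a lift `t` of `φ`, the map `R → I`, `r ↦ ⟨r, t⟩ = ∑ r_s t_s`. -/
def IsLift.pairing {φ : ideal f →ₗ[P] Alg f} {t : σ → P} (ht : IsLift f φ t) :
    Rel f →ₗ[P] ideal f :=
  LinearMap.codRestrict (ideal f) (Fintype.linearCombination P t ∘ₗ (Rel f).subtype) (by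
    intro r
    refine Ideal.Quotient.eq_zero_iff_mem.mp ?_
    have h := ht.mk_eq (r : σ → P)
    have h0 : (⟨pres f (r : σ → P), pres_mem f _⟩ : ideal f) = 0 :=
      Subtype.ext (LinearMap.mem_ker.mp r.2)
    rw [h0, map_zero] at h
    exact h)

theorem IsLift.hom_pairing_koszul {φ ψ : ideal f →ₗ[P] Alg f} {t : σ → P} (ht : IsLift f φ t)
    (u v : σ → P) (r : Rel f) (h : (r : σ → P) = pres f v • u - pres f u • v) :
    ψ (ht.pairing r) =
      φ ⟨pres f u, pres_mem f u⟩ * ψ ⟨pres f v, pres_mem f v⟩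
        - φ ⟨pres f v, pres_mem f v⟩ * ψ ⟨pres f u, pres_mem f u⟩ := by
  have e : ht.pairing r = Fintype.linearCombination P t u • ⟨pres f v, pres_mem f v⟩
      - Fintype.linearCombination P t v • (⟨pres f u, pres_mem f u⟩ : ideal f) := by
    apply Subtype.ext
    simp only [IsLift.pairing, LinearMap.codRestrict_apply, LinearMap.coe_comp,
      Function.comp_apply, Submodule.subtype_apply, h, map_sub, map_smul, smul_eq_mul,
      Submodule.coe_sub, Submodule.coe_smul]
    ring
  rw [e, map_sub, map_smul, map_smul, Algebra.smul_def, Algebra.smul_def,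
    Ideal.Quotient.algebraMap_eq, ht.mk_eq, ht.mk_eq]

/-- The element `r ↦ ψ(⟨r, t⟩) + φ(⟨r, t'⟩)` of `Hom_A(R/R₀, A)`, for lifts `t` of `φ` and `t'`
of `ψ`. -/
def cupHom {φ ψ : ideal f →ₗ[P] Alg f} {t t' : σ → P} (ht : IsLift f φ t) (ht' : IsLift f ψ t') :
    RelHom f :=
  (koszul f).liftQ (ψ ∘ₗ ht.pairing + φ ∘ₗ ht'.pairing) (koszul_le_ker f (by
    intro u v r h
    rw [LinearMap.add_apply, LinearMap.comp_apply, LinearMap.comp_apply,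
      ht.hom_pairing_koszul u v r h, ht'.hom_pairing_koszul u v r h]
    ring))

theorem cupHom_symm {φ ψ : ideal f →ₗ[P] Alg f} {t t' : σ → P} (ht : IsLift f φ t)
    (ht' : IsLift f ψ t') : cupHom ht ht' = cupHom ht' ht := by
  ext r
  simp [cupHom, add_comm]

theorem cupHom_congr_left {φ₁ φ₂ ψ : ideal f →ₗ[P] Alg f} {t₁ t₂ t' : σ → P}
    (h₁ : IsLift f φ₁ t₁) (h₂ : IsLift f φ₂ t₂) (h' : IsLift f ψ t')
    (hφ : φ₁ - φ₂ ∈ LinearMap.range (derToHom k f)) :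
    (Submodule.Quotient.mk (cupHom h₁ h') : T2 f) = Submodule.Quotient.mk (cupHom h₂ h') := by
  obtain ⟨D, hD⟩ := hφ
  have hi : ∀ s, t₁ s - t₂ s - D (f s) ∈ ideal f := by
    intro s
    rw [← Ideal.Quotient.eq_zero_iff_mem, map_sub, map_sub, h₁ s, h₂ s]
    have := LinearMap.congr_fun hD (gen f s)
    simp only [derToHom, LinearMap.coe_mk, AddHom.coe_mk, LinearMap.sub_apply, gen] at this
    rw [this]
    simp [gen]
  rw [Submodule.Quotient.eq]
  refine ⟨Fintype.linearCombination P
    (fun s => ψ ⟨_, hi s⟩ + Ideal.Quotient.mk (ideal f) (D (t' s))), ?_⟩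
  apply Submodule.linearMap_qext
  ext r
  have hr : ∑ s , (r : σ → P) s * f s = 0 := by
    have := LinearMap.mem_ker.mp r.2
    rwa [Fintype.linearCombination_apply] at this
  have hr' : ∑ s , (r : σ → P) s * D (f s)
      = - ∑ s , D ((r : σ → P) s) * f s := by
    have := congrArg D hr
    simp only [map_sum, Derivation.leibniz, smul_eq_mul, map_zero, Finset.sum_add_distrib] at this
    rw [eq_neg_iff_add_eq_zero, ← this]
    simp [mul_comm]
  have e : h₁.pairing r - h₂.pairing r
      = ∑ s , (r : σ → P) s • (⟨_, hi s⟩ : ideal f)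
        - ∑ s , D ((r : σ → P) s) • gen f s := by
    apply Subtype.ext
    simp only [IsLift.pairing, LinearMap.codRestrict_apply, LinearMap.coe_comp,
      Function.comp_apply, Submodule.subtype_apply, Submodule.coe_sub, Submodule.coe_sum,
      Submodule.coe_smul, Fintype.linearCombination_apply, smul_eq_mul, gen]
    simp only [mul_sub, Finset.sum_sub_distrib, hr']
    ring
  have e1 : ψ (h₁.pairing r) - ψ (h₂.pairing r)
      = ∑ s , (r : σ → P) s • ψ (⟨_, hi s⟩ : ideal f)
        - ∑ s , D ((r : σ → P) s) • ψ (gen f s) := by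
    rw [← map_sub, e]
    simp only [map_sub, map_sum, map_smul]
  have e2 : φ₁ (h'.pairing r) - φ₂ (h'.pairing r)
      = ∑ s ,
          (r : σ → P) s • Ideal.Quotient.mk (ideal f) (D (t' s))
        + ∑ s , D ((r : σ → P) s) • ψ (gen f s) := by
    rw [← LinearMap.sub_apply, ← hD]
    simp only [derToHom, LinearMap.coe_mk, AddHom.coe_mk, IsLift.pairing,
      LinearMap.codRestrict_apply, LinearMap.coe_comp,
      Function.comp_apply, Submodule.subtype_apply, Fintype.linearCombination_apply,
      map_sum, smul_eq_mul, Derivation.leibniz, map_add, Finset.sum_add_distrib, map_mul]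
    congr 1
    refine Finset.sum_congr rfl fun s _ => ?_
    rw [h' s, Algebra.smul_def, Ideal.Quotient.algebraMap_eq, mul_comm]
  simp only [restrictHom, cupHom, LinearMap.coe_mk, AddHom.coe_mk, LinearMap.coe_comp,
    Function.comp_apply, Submodule.mkQ_apply, Submodule.liftQ_apply, LinearMap.sub_apply,
    LinearMap.add_apply, Submodule.subtype_apply]
  rw [add_sub_add_comm, e1, e2]
  simp only [Fintype.linearCombination_apply, smul_add, Finset.sum_add_distrib]
  ring

/-- The class of `cupHom` in `T²_A` depends neither on the lifts nor on the representatives of the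
classes in `T¹_A`. -/
theorem cupHom_congr {φ₁ ψ₁ φ₂ ψ₂ : ideal f →ₗ[P] Alg f} {t₁ t₁' t₂ t₂' : σ → P}
    (h₁ : IsLift f φ₁ t₁) (h₁' : IsLift f ψ₁ t₁') (h₂ : IsLift f φ₂ t₂) (h₂' : IsLift f ψ₂ t₂')
    (hφ : φ₁ - φ₂ ∈ LinearMap.range (derToHom k f))
    (hψ : ψ₁ - ψ₂ ∈ LinearMap.range (derToHom k f)) :
    (Submodule.Quotient.mk (cupHom h₁ h₁') : T2 f) = Submodule.Quotient.mk (cupHom h₂ h₂') := by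
  rw [cupHom_congr_left k h₁ h₂ h₁' hφ, cupHom_symm, cupHom_congr_left k h₁' h₂' h₂ hψ,
    cupHom_symm]

/-- The cup product `T¹_A × T¹_A → T²_A`. It sends the classes of `φ` and `ψ` to the class of
`r ↦ ψ(⟨r, t⟩) + φ(⟨r, t'⟩)`, for any lifts `t` of `φ` and `t'` of `ψ` (see `cup_mk`). -/
def cup (x y : T1 k f) : T2 f :=
  Quotient.liftOn₂' x y
    (fun φ ψ => (Submodule.Quotient.mk
      (cupHom (exists_isLift φ).choose_spec (exists_isLift ψ).choose_spec) : T2 f))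
    (fun _ _ _ _ hφ hψ => cupHom_congr k _ _ _ _
      ((Submodule.quotientRel_def _).mp hφ) ((Submodule.quotientRel_def _).mp hψ))

theorem cup_mk {φ ψ : ideal f →ₗ[P] Alg f} {t t' : σ → P} (ht : IsLift f φ t)
    (ht' : IsLift f ψ t') :
    cup k (Submodule.Quotient.mk φ) (Submodule.Quotient.mk ψ)
      = (Submodule.Quotient.mk (cupHom ht ht') : T2 f) :=
  cupHom_congr k _ _ _ _ (by simp) (by simp)

end Modules

end Cotangent

/-! ## Stanley–Reisner rings -/

namespace StanleyReisner

open Cotangent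

noncomputable section Rings

/-- The polynomial ring `ℂ[x_0, …, x_n]`. -/
abbrev Poly (n : ℕ) : Type := MvPolynomial (Fin (n + 1)) ℂ

variable {n : ℕ} (X : LowerSet (Finset (Fin (n + 1))))

/-- The non-faces of `X`. -/
abbrev NonFace : Type := {p : Finset (Fin (n + 1)) // p ∉ X}

instance : Fintype (NonFace X) := Fintype.ofFinite _

/-- The generators `x^p = ∏_{i ∈ p} x_i`, `p ∉ X`, of the Stanley–Reisner ideal. -/
def srGen (p : NonFace X) : Poly n := ∏ i ∈ p.1, MvPolynomial.X i

/-- The Stanley–Reisner ring `A_X`. -/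
abbrev SRRing : Type := Alg (srGen X)

/-- `T¹` of the Stanley–Reisner ring. -/
abbrev SRT1 : Type := T1 ℂ (srGen X)

/-- `T²` of the Stanley–Reisner ring. -/
abbrev SRT2 : Type := T2 (srGen X)

/-! ### The multigrading by `ℤ^{n+1}` -/

/-- The exponent vector of a subset `p ⊆ {0, …, n}`. -/
def ind (p : Finset (Fin (n + 1))) : Fin (n + 1) → ℤ := fun i => if i ∈ p then 1 else 0

/-- The degree `e` part of the polynomial ring; it is zero if `e` has a negative entry. -/
def polyDeg (e : Fin (n + 1) → ℤ) : Submodule ℂ (Poly n) :=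
  Submodule.span ℂ {u | ∃ m : Fin (n + 1) →₀ ℕ, (∀ i, (m i : ℤ) = e i) ∧
    u = MvPolynomial.monomial m 1}

/-- The degree `e` part of `A_X`. -/
def ringDeg (e : Fin (n + 1) → ℤ) : Submodule ℂ (SRRing X) :=
  (polyDeg e).map (Ideal.Quotient.mkₐ ℂ (ideal (srGen X))).toLinearMap

/-- `φ ∈ Hom(I_X, A_X)_c`: the map `φ` is homogeneous of degree `c`. -/
def IsHomogHom (c : Fin (n + 1) → ℤ) (φ : ideal (srGen X) →ₗ[Poly n] SRRing X) : Prop :=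
  ∀ (e : Fin (n + 1) → ℤ) (u : ideal (srGen X)), (u : Poly n) ∈ polyDeg e →
    φ u ∈ ringDeg X (e + c)

/-- `h ∈ Hom(R/R₀, A_X)_c`: the map `h` is homogeneous of degree `c`, where the basis vector `e_p`
of `P^σ ⊇ R` has degree `p`. -/
def IsHomogRelHom (c : Fin (n + 1) → ℤ) (h : RelHom (srGen X)) : Prop :=
  ∀ (e : Fin (n + 1) → ℤ) (r : Rel (srGen X)),
    (∀ p : NonFace X, (r : NonFace X → Poly n) p ∈ polyDeg (e - ind p.1)) →
      h (Submodule.Quotient.mk r) ∈ ringDeg X (e + c)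

/-- `T¹_c`, the degree `c` part of `T¹`. -/
def t1Deg (c : Fin (n + 1) → ℤ) : Set (SRT1 X) :=
  {x | ∃ φ, IsHomogHom X c φ ∧ x = Submodule.Quotient.mk φ}

/-- `T²_c`, the degree `c` part of `T²`. -/
def t2Deg (c : Fin (n + 1) → ℤ) : Set (SRT2 X) :=
  {z | ∃ h, IsHomogRelHom X c h ∧ z = Submodule.Quotient.mk h}

/-- The support `a` of the positive part of `c`. -/
def pos (c : Fin (n + 1) → ℤ) : Finset (Fin (n + 1)) := Finset.univ.filter fun i => 0 < c i

/-- The support `b` of the negative part of `c`. -/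
def neg (c : Fin (n + 1) → ℤ) : Finset (Fin (n + 1)) := Finset.univ.filter fun i => c i < 0

/-- The locus of multiplicity at least two in the positive part of `c`. -/
def posTwo (c : Fin (n + 1) → ℤ) : Finset (Fin (n + 1)) := Finset.univ.filter fun i => 2 ≤ c i

/-! ### The `N`-description -/

/-- The set `N_{a-b}`. -/
def setN (a b : Finset (Fin (n + 1))) : Set (Finset (Fin (n + 1))) :=
  {f | f ∈ X ∧ a ⊆ f ∧ f ∩ b = ∅ ∧ f ∪ b ∉ X}

/-- The set `Ñ_{a-b}`; here `b'` runs through the proper subsets of `b`. -/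
def setN' (a b : Finset (Fin (n + 1))) : Set (Finset (Fin (n + 1))) :=
  {f | f ∈ setN X a b ∧ ∃ b', b' ⊂ b ∧ f ∪ b' ∉ X}

/-- The class in `A_X` of the monomial `x^m`. -/
def mono (m : Fin (n + 1) →₀ ℕ) : SRRing X :=
  Ideal.Quotient.mk (ideal (srGen X)) (MvPolynomial.monomial m 1)

/-- `l`, restricted to `N_{a-b}`, is a function `λ : N_{a-b} → ℂ` which describes an element of
`Hom(I_X, A_X)_c`, where `c = a - b`: it vanishes on `Ñ_{a-b}` and `λ(f) = λ(g)` if `f ∪ g ∈ X`.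
Outside `X` the function `l` is zero; on `X \ N_{a-b}` it is arbitrary. -/
structure IsN1 (c : Fin (n + 1) → ℤ) (l : Finset (Fin (n + 1)) → ℂ) : Prop where
  zero_off : ∀ f, f ∉ X → l f = 0
  zero : ∀ f ∈ setN' X (pos c) (neg c), l f = 0
  eq : ∀ f ∈ setN X (pos c) (neg c), ∀ g ∈ setN X (pos c) (neg c), f ∪ g ∈ X → l f = l g

/-- The class `x ∈ T¹_c` is described by the function `l` on `N_{a-b}`: it is represented by the
homomorphism `x^p ↦ l((p ∪ a) \ b) x^{p + c}` of degree `c`. (If `p + c` has a negative entry, then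
`x^p ↦ 0` by homogeneity. If `(p ∪ a) \ b ∉ X`, then `x^{p + c} = 0` in `A_X`.) -/
def Describes1 (c : Fin (n + 1) → ℤ) (l : Finset (Fin (n + 1)) → ℂ) (x : SRT1 X) : Prop :=
  IsN1 X c l ∧ ∃ φ, IsHomogHom X c φ ∧ x = Submodule.Quotient.mk φ ∧
    ∀ (p : NonFace X) (m : Fin (n + 1) →₀ ℕ), (∀ i, (m i : ℤ) = ind p.1 i + c i) →
      φ (gen (srGen X) p) = l ((p.1 ∪ pos c) \ neg c) • mono X m

/-- `l`, restricted to `N_{a-b}^{(2)}`, is an antisymmetric function which vanishes on pairs of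
elements of `Ñ_{a-b}` and satisfies the cocycle condition. -/
structure IsN2 (c : Fin (n + 1) → ℤ) (l : Finset (Fin (n + 1)) → Finset (Fin (n + 1)) → ℂ) :
    Prop where
  antisymm : ∀ f ∈ setN X (pos c) (neg c), ∀ g ∈ setN X (pos c) (neg c), f ∪ g ∈ X →
    l f g = - l g f
  zero : ∀ f ∈ setN' X (pos c) (neg c), ∀ g ∈ setN' X (pos c) (neg c), f ∪ g ∈ X → l f g = 0
  cocycle : ∀ f ∈ setN X (pos c) (neg c), ∀ g ∈ setN X (pos c) (neg c),
    ∀ h ∈ setN X (pos c) (neg c), f ∪ g ∪ h ∈ X → l f g - l f h + l g h = 0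

open Classical in
/-- The relation `R_{p,q} = x^{q \ p} e_p - x^{p \ q} e_q`. These relations generate `R`. -/
def taylorRel (p q : NonFace X) : Rel (srGen X) :=
  ⟨Pi.single p (∏ i ∈ q.1 \ p.1, MvPolynomial.X i)
      - Pi.single q (∏ i ∈ p.1 \ q.1, MvPolynomial.X i), by
    rw [LinearMap.mem_ker, map_sub, Fintype.linearCombination_apply_single,
      Fintype.linearCombination_apply_single, smul_eq_mul, smul_eq_mul, srGen, srGen,
      ← Finset.prod_union Finset.sdiff_disjoint, ← Finset.prod_union Finset.sdiff_disjoint,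
      Finset.sdiff_union_self_eq_union, Finset.sdiff_union_self_eq_union, Finset.union_comm,
      sub_self]⟩

/-- The class `z ∈ T²_c` is described by the function `l` on `N_{a-b}^{(2)}`: it is represented by
the homomorphism `R_{p,q} ↦ l((p ∪ a) \ b, (q ∪ a) \ b) x^{p ∪ q + c}` of degree `c`. (If
`p ∪ q + c` has a negative entry, then `R_{p,q} ↦ 0` by homogeneity. If `(p ∪ q ∪ a) \ b ∉ X`, then
`x^{p ∪ q + c} = 0` in `A_X`.) -/
def Describes2 (c : Fin (n + 1) → ℤ) (l : Finset (Fin (n + 1)) → Finset (Fin (n + 1)) → ℂ)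
    (z : SRT2 X) : Prop :=
  IsN2 X c l ∧ ∃ h, IsHomogRelHom X c h ∧ z = Submodule.Quotient.mk h ∧
    ∀ (p q : NonFace X) (m : Fin (n + 1) →₀ ℕ), (∀ i, (m i : ℤ) = ind (p.1 ∪ q.1) i + c i) →
      h (Submodule.Quotient.mk (taylorRel X p q))
        = l ((p.1 ∪ pos c) \ neg c) ((q.1 ∪ pos c) \ neg c) • mono X m

/-- `d f` is, for each `f ∈ N_{a-b}`, a maximal subset `d ⊆ b` such that `f ∪ (b \ d) ∉ X`. -/
def IsMaxChoice (a b : Finset (Fin (n + 1))) (d : Finset (Fin (n + 1)) → Finset (Fin (n + 1))) :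
    Prop :=
  ∀ f ∈ setN X a b, Maximal (fun s => s ⊆ b ∧ f ∪ (b \ s) ∉ X) (d f)

/-- The expression for the value of the cup product on a pair `(f, g)`, where `d`, `e` are the
auxiliary subsets chosen for `f` and `g`, and `φ`, `ψ` are functions on sets. -/
def cupValue (a₁ b₁ a₂ b₂ d e f g : Finset (Fin (n + 1))) (φ ψ : Finset (Fin (n + 1)) → ℂ) : ℂ :=
  (φ ((f \ b₁) ∪ (b₂ \ d)) - φ ((g \ b₁) ∪ (b₂ \ e))) * ψ ((f ∪ g ∪ a₂) \ b₂)
    + (ψ ((f \ b₂) ∪ (b₁ \ d)) - ψ ((g \ b₂) ∪ (b₁ \ e))) * φ ((f ∪ g ∪ a₁) \ b₁)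

end Rings

end StanleyReisner

namespace StanleyReisner

open Cotangent MvPolynomial

noncomputable section CupProduct

variable {n : ℕ}

/-! The relations $R_{p,q}$ generate $R$ (`span_taylorRel`) and have squarefree degree $p\cup q$. A
homogeneous map on $R/R_0$ whose degree has an entry below $-1$ therefore vanishes, and likewise for
maps on $I$. This settles the case $b^1\cap b^2\ne\emptyset$ and the case of non-reduced $\mathbf
b^i$.

In the remaining case take the lifts $\varphi(\dots)x^{p+\mathbf c^1}$ and $\psi(\dots)x^{p+\mathbf
c^2}$. The pairing of $R_{p,q}$ with the first is $(\varphi_p-\varphi_q)\,x^{p\cup q+\mathbf c^1}$.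
If the difference is nonzero, the support of this monomial is a non-face, and $\psi$ can be read off
there. So the cup product sends $R_{p,q}$ to $\mu(p,q)\,x^{p\cup q+\mathbf c}$ with the explicit
coefficient `cupCoeff` (`exists_relHom`).

In general $\mu(p,q)$ depends on more than $(p\cup a)\setminus b$ and $(q\cup a)\setminus b$. To
remove this dependence, choose for each $f\in N_{a-b}$ one non-face $s(f)=f\cup(b\setminus d_f)$
above $f$ and subtract the restriction of the map $e_p\mapsto\mu(p,s(f))\,x^{p+\mathbf c}$ for
$b\subseteq p$, where $f=(p\cup a)\setminus b$. By the cocycle identity (`IsRelCoeff.cocycle`) the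
new coefficient is $\mu(s(f),s(g))$. For $b\not\subseteq p$ no correction is possible. There
$\mu(p,s(f))$ must already vanish, which follows from the Koszul relations
(`IsRelCoeff.eq_zero_of_not_subset`) once $b\not\subseteq s(f)$, and maximality of $d_f$ guarantees
this. Finally $\mu(s(f),s(g))$ is the stated formula (`cupValue_eq_cupCoeff`). -/

/-! ### Monomials with integer exponents -/

/-- The monomial `x^e`, read as `0` if `e` has a negative entry. -/
def ipoly (e : Fin (n + 1) → ℤ) : Poly n :=
  open Classical in
  if 0 ≤ e then monomial (Finsupp.equivFunOnFinite.symm fun i => (e i).toNat) 1 else 0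

theorem ipoly_eq_monomial {e : Fin (n + 1) → ℤ} {m : Fin (n + 1) →₀ ℕ}
    (h : ∀ i, (m i : ℤ) = e i) : ipoly e = monomial m 1 := by
  have h0 : 0 ≤ e := fun i => by simp [← h i]
  rw [ipoly, if_pos h0]
  congr 2
  ext i
  simp [← h i]

theorem exists_exponent {e : Fin (n + 1) → ℤ} (h : 0 ≤ e) :
    ∃ m : Fin (n + 1) →₀ ℕ, ∀ i, (m i : ℤ) = e i :=
  ⟨Finsupp.equivFunOnFinite.symm fun i => (e i).toNat, fun i => by simpa using h i⟩

theorem ipoly_of_not_nonneg {e : Fin (n + 1) → ℤ} (h : ¬ 0 ≤ e) : ipoly e = 0 := if_neg h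

/-- Both exponents must be nonnegative: otherwise a factor is read as $0$ although $e+e'$ may be
nonnegative. This is the source of the later case distinctions on whether `neg c` lies in a given
set. -/
theorem ipoly_mul {e e' : Fin (n + 1) → ℤ} (h : 0 ≤ e) (h' : 0 ≤ e') :
    ipoly e * ipoly e' = ipoly (e + e') := by
  obtain ⟨m, hm⟩ := exists_exponent h
  obtain ⟨m', hm'⟩ := exists_exponent h'
  rw [ipoly_eq_monomial hm, ipoly_eq_monomial hm', ipoly_eq_monomial (m := m + m'), monomial_mul,
    mul_one]
  intro i
  simp [hm i, hm' i]

theorem ind_nonneg (p : Finset (Fin (n + 1))) : 0 ≤ ind p := fun i => by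
  simp only [ind, Pi.zero_apply]; split_ifs <;> simp

theorem prod_X_eq_ipoly (p : Finset (Fin (n + 1))) :
    ∏ i ∈ p, (X i : Poly n) = ipoly (ind p) := by
  rw [ipoly_eq_monomial (m := ∑ i ∈ p, Finsupp.single i 1)]
  · rw [monomial_sum_one]; rfl
  · intro i
    simp [ind, Finsupp.single_apply]

theorem mem_polyDeg {e : Fin (n + 1) → ℤ} {u : Poly n} :
    u ∈ polyDeg e ↔ ∃ a : ℂ, u = a • ipoly e := by
  have : polyDeg e = Submodule.span ℂ {ipoly e} := by
    apply le_antisymm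
    · rw [polyDeg, Submodule.span_le]
      rintro _ ⟨m, hm, rfl⟩
      rw [← ipoly_eq_monomial hm]
      exact Submodule.mem_span_singleton_self _
    · rw [Submodule.span_singleton_le_iff_mem]
      by_cases h : 0 ≤ e
      · obtain ⟨m, hm⟩ := exists_exponent h
        exact Submodule.subset_span ⟨m, hm, ipoly_eq_monomial hm⟩
      · rw [ipoly_of_not_nonneg h]; exact zero_mem _
  rw [this, Submodule.mem_span_singleton]
  simp only [eq_comm]

theorem mul_mem_polyDeg {e e' : Fin (n + 1) → ℤ} {u v : Poly n} (hu : u ∈ polyDeg e)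
    (hv : v ∈ polyDeg e') : u * v ∈ polyDeg (e + e') := by
  obtain ⟨a, rfl⟩ := mem_polyDeg.1 hu
  obtain ⟨b, rfl⟩ := mem_polyDeg.1 hv
  by_cases h : 0 ≤ e
  · by_cases h' : 0 ≤ e'
    · exact mem_polyDeg.2 ⟨a * b, by rw [← ipoly_mul h h', smul_mul_smul_comm]⟩
    · simp [ipoly_of_not_nonneg h']
  · simp [ipoly_of_not_nonneg h]

/-! ### Monomials in the Stanley–Reisner ring -/

variable (X : LowerSet (Finset (Fin (n + 1))))

/-- The class of `x^e` in `A_X`, read as `0` if `e` has a negative entry. -/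
def imono (e : Fin (n + 1) → ℤ) : SRRing X := Ideal.Quotient.mk _ (ipoly e)

theorem imono_eq_mono {e : Fin (n + 1) → ℤ} {m : Fin (n + 1) →₀ ℕ} (h : ∀ i, (m i : ℤ) = e i) :
    imono X e = mono X m := by
  rw [imono, ipoly_eq_monomial h, mono]

theorem imono_of_not_nonneg {e : Fin (n + 1) → ℤ} (h : ¬ 0 ≤ e) : imono X e = 0 := by
  rw [imono, ipoly_of_not_nonneg h, map_zero]

theorem ipoly_smul_imono {e e' : Fin (n + 1) → ℤ} (h : 0 ≤ e) (h' : 0 ≤ e') :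
    ipoly e • imono X e' = imono X (e + e') := by
  rw [imono, imono, ← ipoly_mul h h', map_mul, Algebra.smul_def, Ideal.Quotient.algebraMap_eq]

theorem mem_ringDeg {e : Fin (n + 1) → ℤ} {v : SRRing X} :
    v ∈ ringDeg X e ↔ ∃ a : ℂ, v = a • imono X e := by
  constructor
  · rintro ⟨u, hu, rfl⟩
    obtain ⟨a, rfl⟩ := mem_polyDeg.1 hu
    exact ⟨a, by simp [imono]⟩
  · rintro ⟨a, rfl⟩
    exact ⟨a • ipoly e, mem_polyDeg.2 ⟨a, rfl⟩, by simp [imono]⟩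

theorem srGen_eq_ipoly (p : NonFace X) : srGen X p = ipoly (ind p.1) := prod_X_eq_ipoly _

/-- A monomial lies in a monomial ideal iff a generator divides it, and $x^p$ divides $x^e$ iff $p$
is contained in the support of $e$. If some such $p$ is a non-face, so is the support. -/
theorem ipoly_mem_ideal_iff {e : Fin (n + 1) → ℤ} (h : 0 ≤ e) :
    ipoly e ∈ ideal (srGen X) ↔ pos e ∉ X := by
  obtain ⟨m, hm⟩ := exists_exponent h
  have hr : Set.range (srGen X) = (fun s => monomial s (1 : ℂ)) ''
      Set.range fun p : NonFace X => ∑ i ∈ p.1, Finsupp.single i 1 := by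
    rw [← Set.range_comp]
    congr 1
    ext1 p
    rw [srGen_eq_ipoly, ipoly_eq_monomial]
    · rfl
    · intro i
      simp [ind, Finsupp.single_apply]
  rw [ideal, hr, mem_ideal_span_monomial_image, ipoly_eq_monomial hm, support_monomial,
    if_neg one_ne_zero]
  simp only [Finset.mem_singleton, Set.mem_range, exists_exists_eq_and, forall_eq]
  have key (p : Finset (Fin (n + 1))) : ∑ i ∈ p, Finsupp.single i 1 ≤ m ↔ p ⊆ pos e := by
    rw [Finsupp.le_def]
    refine forall_congr' fun i => ?_
    have := hm i
    simp only [Finsupp.finsetSum_apply, Finsupp.single_apply, Finset.sum_ite_eq', pos,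
      Finset.mem_filter, Finset.mem_univ, true_and]
    split_ifs with hi <;> simp [hi]; omega
  simp only [key]
  constructor
  · rintro ⟨p, hp⟩ hX
    exact p.2 (X.lower hp hX)
  · exact fun hX => ⟨⟨_, hX⟩, subset_rfl⟩

theorem imono_of_pos_notMem {e : Fin (n + 1) → ℤ} (h : pos e ∉ X) : imono X e = 0 := by
  by_cases h0 : 0 ≤ e
  · exact Ideal.Quotient.eq_zero_iff_mem.2 ((ipoly_mem_ideal_iff X h0).2 h)
  · exact imono_of_not_nonneg X h0

theorem imono_ne_zero {e : Fin (n + 1) → ℤ} (h0 : 0 ≤ e) (h : pos e ∈ X) : imono X e ≠ 0 :=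
  fun h' => (ipoly_mem_ideal_iff X h0).1 (Ideal.Quotient.eq_zero_iff_mem.1 h') h

variable {X}

/-! ### Homogeneous maps and the degree of the cup product -/

theorem IsHomogHom.apply_gen {c : Fin (n + 1) → ℤ} {φ : ideal (srGen X) →ₗ[Poly n] SRRing X}
    (h : IsHomogHom X c φ) (p : NonFace X) :
    ∃ a : ℂ, φ (gen (srGen X) p) = a • imono X (ind p.1 + c) :=
  (mem_ringDeg X).1 (h (ind p.1) _ (mem_polyDeg.2 ⟨1, by rw [one_smul, ← srGen_eq_ipoly]; rfl⟩))

theorem IsHomogHom.exists_isLift {c : Fin (n + 1) → ℤ}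
    {φ : ideal (srGen X) →ₗ[Poly n] SRRing X} (h : IsHomogHom X c φ) :
    ∃ t, IsLift (srGen X) φ t ∧ ∀ p, t p ∈ polyDeg (ind p.1 + c) := by
  choose a ha using h.apply_gen
  exact ⟨fun p => a p • ipoly (ind p.1 + c), fun p => by rw [ha]; rfl,
    fun p => mem_polyDeg.2 ⟨_, rfl⟩⟩

theorem IsHomogHom.pairing_mem {c₁ c₂ e : Fin (n + 1) → ℤ}
    {φ ψ : ideal (srGen X) →ₗ[Poly n] SRRing X} (hψ : IsHomogHom X c₂ ψ)
    {t : NonFace X → Poly n} (ht : IsLift (srGen X) φ t) (htd : ∀ p, t p ∈ polyDeg (ind p.1 + c₁))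
    {r : Rel (srGen X)} (hr : ∀ p, (r : NonFace X → Poly n) p ∈ polyDeg (e - ind p.1)) :
    ψ (ht.pairing r) ∈ ringDeg X (e + (c₁ + c₂)) := by
  rw [← add_assoc]
  apply hψ
  change Fintype.linearCombination _ t (r : NonFace X → Poly n) ∈ _
  rw [Fintype.linearCombination_apply]
  refine Submodule.sum_mem _ fun p _ => ?_
  have := mul_mem_polyDeg (hr p) (htd p)
  rwa [← add_assoc, sub_add_cancel] at this

theorem isHomogRelHom_cupHom {c₁ c₂ : Fin (n + 1) → ℤ}
    {φ ψ : ideal (srGen X) →ₗ[Poly n] SRRing X} (hφ : IsHomogHom X c₁ φ) (hψ : IsHomogHom X c₂ ψ)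
    {t t' : NonFace X → Poly n} (ht : IsLift (srGen X) φ t) (ht' : IsLift (srGen X) ψ t')
    (htd : ∀ p, t p ∈ polyDeg (ind p.1 + c₁)) (htd' : ∀ p, t' p ∈ polyDeg (ind p.1 + c₂)) :
    IsHomogRelHom X (c₁ + c₂) (cupHom ht ht') := by
  intro e r hr
  refine add_mem (hψ.pairing_mem ht htd hr) ?_
  rw [add_comm c₁]
  exact hφ.pairing_mem ht' htd' hr

theorem cup_mem_t2Deg {c₁ c₂ : Fin (n + 1) → ℤ} {x y : SRT1 X} (hx : x ∈ t1Deg X c₁)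
    (hy : y ∈ t1Deg X c₂) : cup ℂ x y ∈ t2Deg X (c₁ + c₂) := by
  obtain ⟨φ, hφ, rfl⟩ := hx
  obtain ⟨ψ, hψ, rfl⟩ := hy
  obtain ⟨t, ht, htd⟩ := hφ.exists_isLift
  obtain ⟨t', ht', htd'⟩ := hψ.exists_isLift
  exact ⟨_, isHomogRelHom_cupHom hφ hψ ht ht' htd htd', cup_mk ℂ ht ht'⟩

/-! ### Generators of the relations, and vanishing for degree reasons -/

theorem coe_taylorRel (p q : NonFace X) : (taylorRel X p q : NonFace X → Poly n) =
    open Classical in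
    Pi.single p (ipoly (ind (q.1 \ p.1))) - Pi.single q (ipoly (ind (p.1 \ q.1))) := by
  simp only [taylorRel, ← prod_X_eq_ipoly]

theorem ind_add_ind_sdiff (p q : Finset (Fin (n + 1))) :
    ind (q \ p) + ind p = ind (p ∪ q) := by
  ext i
  simp only [ind, Pi.add_apply, Finset.mem_union, Finset.mem_sdiff]
  split_ifs <;> simp_all

-- Two terms of the same degree differ by a monomial multiple $x^k R_{p,q}$: the common degree
-- dominates $p\cup q$, and $k$ is the excess.
open Classical in
theorem single_sub_single_mem_span_taylorRel {p q : NonFace X} {m m' : Fin (n + 1) → ℤ}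
    (hm : 0 ≤ m) (hm' : 0 ≤ m') (h : m + ind p.1 = m' + ind q.1) :
    (Pi.single p (ipoly m) - Pi.single q (ipoly m') : NonFace X → Poly n) ∈
      Submodule.span (Poly n) (Set.range fun s : NonFace X × NonFace X =>
        (taylorRel X s.1 s.2 : NonFace X → Poly n)) := by
  set k := m - ind (q.1 \ p.1) with hk
  have hk' : k = m' - ind (p.1 \ q.1) := by
    have h1 := ind_add_ind_sdiff p.1 q.1
    have h2 := ind_add_ind_sdiff q.1 p.1
    rw [Finset.union_comm] at h2
    linear_combination h - h1 + h2
  have hk0 : 0 ≤ k := by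
    intro i
    have h1 := hm i
    have h2 := hm' i
    have h3 := congrFun h i
    simp only [hk, ind, Pi.sub_apply, Pi.add_apply, Pi.zero_apply, Finset.mem_sdiff] at *
    split_ifs at * <;> simp_all
  have e1 : ipoly m = ipoly k * ipoly (ind (q.1 \ p.1)) := by
    rw [ipoly_mul hk0 (ind_nonneg _), hk, sub_add_cancel]
  have e2 : ipoly m' = ipoly k * ipoly (ind (p.1 \ q.1)) := by
    rw [ipoly_mul hk0 (ind_nonneg _), hk', sub_add_cancel]
  have : (Pi.single p (ipoly m) - Pi.single q (ipoly m') : NonFace X → Poly n)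
      = ipoly k • (taylorRel X p q : NonFace X → Poly n) := by
    rw [coe_taylorRel, e1, e2, smul_sub, ← Pi.single_smul, ← Pi.single_smul, smul_eq_mul,
      smul_eq_mul]
  rw [this]
  exact Submodule.smul_mem _ _ (Submodule.subset_span ⟨(p, q), rfl⟩)

/-- The relations `R_{p,q}` generate `R`. -/
theorem span_taylorRel (X : LowerSet (Finset (Fin (n + 1)))) : Submodule.span (Poly n)
    (Set.range fun s : NonFace X × NonFace X => taylorRel X s.1 s.2) = ⊤ := by
  classical
  set M := Submodule.span (Poly n) (Set.range fun s : NonFace X × NonFace X =>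
        (taylorRel X s.1 s.2 : NonFace X → Poly n)) with hM
  suffices h : Rel (srGen X) ≤ M by
    rw [eq_top_iff]
    rintro r -
    have hr := h r.2
    rw [hM, show (Set.range fun s : NonFace X × NonFace X =>
        (taylorRel X s.1 s.2 : NonFace X → Poly n)) = (Rel (srGen X)).subtype '' (Set.range
          fun s : NonFace X × NonFace X => taylorRel X s.1 s.2) by rw [← Set.range_comp]; rfl,
      Submodule.span_image] at hr
    obtain ⟨r', hr', e⟩ := hr
    rwa [← Subtype.ext e]
  -- A `ℂ`-linear splitting: `x^m e_p` depends modulo `M` only on the degree of `x^m x^p`.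
  let rep : (Fin (n + 1) →₀ ℕ) → (NonFace X → Poly n) ⧸ M := fun m =>
    if h : ∃ s : NonFace X × (Fin (n + 1) →₀ ℕ), ∀ i, ((m i : ℕ) : ℤ) = s.2 i + ind s.1.1 i then
      M.mkQ (Pi.single h.choose.1 (monomial h.choose.2 1)) else 0
  let θ : Poly n →ₗ[ℂ] (NonFace X → Poly n) ⧸ M := (basisMonomials (Fin (n + 1)) ℂ).constr ℂ rep
  have hθ : θ ∘ₗ (pres (srGen X)).restrictScalars ℂ = M.mkQ.restrictScalars ℂ := by
    refine LinearMap.pi_ext' fun p => ?_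
    refine (basisMonomials (Fin (n + 1)) ℂ).ext fun m => ?_
    rw [coe_basisMonomials]
    simp only [LinearMap.comp_apply, LinearMap.single_apply, LinearMap.restrictScalars_apply]
    rw [Fintype.linearCombination_apply_single, srGen_eq_ipoly]
    have m0 : (0 : Fin (n + 1) → ℤ) ≤ fun i => (m i : ℤ) := fun i => by simp
    obtain ⟨m', hm'⟩ := exists_exponent (add_nonneg m0 (ind_nonneg p.1))
    rw [← ipoly_eq_monomial (e := fun i => (m i : ℤ)) (fun _ => rfl), smul_eq_mul,
      ipoly_mul m0 (ind_nonneg _), ipoly_eq_monomial (m := m') hm']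
    have h : ∃ s : NonFace X × (Fin (n + 1) →₀ ℕ), ∀ i, ((m' i : ℕ) : ℤ) = s.2 i + ind s.1.1 i :=
      ⟨(p, m), hm'⟩
    have : θ (monomial m' 1) = rep m' := by
      simpa using (basisMonomials (Fin (n + 1)) ℂ).constr_basis ℂ rep m'
    rw [this]
    simp only [rep]
    rw [dif_pos h, ← sub_eq_zero, ← map_sub]
    refine (Submodule.Quotient.mk_eq_zero _).2 ?_
    rw [← ipoly_eq_monomial (e := fun i => (h.choose.2 i : ℤ)) (fun _ => rfl)]
    refine single_sub_single_mem_span_taylorRel (fun i => by simp) m0 ?_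
    ext i
    exact (h.choose_spec i).symm.trans (hm' i)
  intro r hr
  have := LinearMap.congr_fun hθ r
  simp only [LinearMap.comp_apply, LinearMap.restrictScalars_apply, LinearMap.mem_ker.1 hr,
    map_zero] at this
  exact (Submodule.Quotient.mk_eq_zero _).1 this.symm

theorem relHom_eq_zero {h : RelHom (srGen X)}
    (H : ∀ p q, h (Submodule.Quotient.mk (taylorRel X p q)) = 0) : h = 0 := by
  apply Submodule.linearMap_qext
  refine LinearMap.ext_on_range (span_taylorRel X) fun s => ?_
  exact H s.1 s.2

theorem taylorRel_mem_polyDeg (p q s : NonFace X) :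
    (taylorRel X p q : NonFace X → Poly n) s ∈ polyDeg (ind (p.1 ∪ q.1) - ind s.1) := by
  classical
  rw [coe_taylorRel, Pi.sub_apply]
  refine sub_mem ?_ ?_
  · rcases eq_or_ne s p with rfl | h
    · rw [Pi.single_eq_same, ← ind_add_ind_sdiff, add_sub_cancel_right]
      exact mem_polyDeg.2 ⟨1, (one_smul _ _).symm⟩
    · rw [Pi.single_eq_of_ne h]; exact zero_mem _
  · rcases eq_or_ne s q with rfl | h
    · rw [Pi.single_eq_same, Finset.union_comm, ← ind_add_ind_sdiff, add_sub_cancel_right]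
      exact mem_polyDeg.2 ⟨1, (one_smul _ _).symm⟩
    · rw [Pi.single_eq_of_ne h]; exact zero_mem _

/-- The generators $R_{p,q}$ have squarefree degree, so adding $c$ leaves a negative $i$-th
exponent. -/
theorem IsHomogRelHom.eq_zero_of_lt {c : Fin (n + 1) → ℤ} {h : RelHom (srGen X)}
    (hh : IsHomogRelHom X c h) {i : Fin (n + 1)} (hi : c i < -1) : h = 0 := by
  refine relHom_eq_zero fun p q => ?_
  obtain ⟨a, ha⟩ := (mem_ringDeg X).1 (hh _ _ (taylorRel_mem_polyDeg p q))
  rw [ha, imono_of_not_nonneg, smul_zero]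
  intro h0
  have := h0 i
  simp only [Pi.zero_apply, Pi.add_apply, ind] at this
  split_ifs at this <;> omega

theorem IsHomogHom.eq_zero_of_lt {c : Fin (n + 1) → ℤ}
    {φ : ideal (srGen X) →ₗ[Poly n] SRRing X} (h : IsHomogHom X c φ) {i : Fin (n + 1)}
    (hi : c i < -1) : φ = 0 := by
  ext ⟨u, hu⟩
  induction hu using Submodule.span_induction with
  | mem u hu =>
    obtain ⟨p, rfl⟩ := hu
    obtain ⟨a, ha⟩ := h.apply_gen p
    refine ha.trans ?_
    rw [imono_of_not_nonneg, smul_zero, LinearMap.zero_apply]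
    intro h0
    have := h0 i
    simp only [Pi.zero_apply, Pi.add_apply, ind] at this
    split_ifs at this <;> omega
  | zero => exact map_zero φ
  | add u v hu hv h1 h2 =>
    simpa [h1, h2] using map_add φ ⟨u, hu⟩ ⟨v, hv⟩
  | smul a u hu h1 =>
    simpa [h1] using map_smul φ a ⟨u, hu⟩

theorem cup_zero_left (y : SRT1 X) : cup ℂ 0 y = 0 := by
  obtain ⟨ψ, rfl⟩ := Submodule.Quotient.mk_surjective _ y
  obtain ⟨t', ht'⟩ := Cotangent.exists_isLift ψ
  have ht : IsLift (srGen X) 0 0 := fun s => by simp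
  rw [← Submodule.Quotient.mk_zero, cup_mk ℂ ht ht', Submodule.Quotient.mk_eq_zero,
    show cupHom ht ht' = 0 from ?_]
  · exact zero_mem _
  apply Submodule.linearMap_qext
  ext1 r
  have : ht.pairing r = 0 := Subtype.ext (by simp [IsLift.pairing, Fintype.linearCombination_apply])
  simp [cupHom, this]

theorem cup_comm (x y : SRT1 X) : cup ℂ x y = cup ℂ y x := by
  obtain ⟨φ, rfl⟩ := Submodule.Quotient.mk_surjective _ x
  obtain ⟨ψ, rfl⟩ := Submodule.Quotient.mk_surjective _ y
  obtain ⟨t, ht⟩ := Cotangent.exists_isLift φ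
  obtain ⟨t', ht'⟩ := Cotangent.exists_isLift ψ
  rw [cup_mk ℂ ht ht', cup_mk ℂ ht' ht, cupHom_symm]

theorem cup_eq_zero_of_lt {c : Fin (n + 1) → ℤ} {x : SRT1 X} (hx : x ∈ t1Deg X c)
    {i : Fin (n + 1)} (hi : c i < -1) (y : SRT1 X) : cup ℂ x y = 0 := by
  obtain ⟨φ, hφ, rfl⟩ := hx
  rw [hφ.eq_zero_of_lt hi, Submodule.Quotient.mk_zero, cup_zero_left]

theorem cup_eq_zero_of_neg_inter {c₁ c₂ : Fin (n + 1) → ℤ} (h : (neg c₁ ∩ neg c₂).Nonempty)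
    {x y : SRT1 X} (hx : x ∈ t1Deg X c₁) (hy : y ∈ t1Deg X c₂) : cup ℂ x y = 0 := by
  obtain ⟨i, hi⟩ := h
  simp only [neg, Finset.mem_inter, Finset.mem_filter, Finset.mem_univ, true_and] at hi
  obtain ⟨h, hh, e⟩ := cup_mem_t2Deg hx hy
  rw [e, hh.eq_zero_of_lt (i := i) (by rw [Pi.add_apply]; omega), Submodule.Quotient.mk_zero]

/-! ### Supports of exponent vectors -/

theorem mem_pos {c : Fin (n + 1) → ℤ} {i : Fin (n + 1)} : i ∈ pos c ↔ 0 < c i := by simp [pos]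

theorem mem_neg {c : Fin (n + 1) → ℤ} {i : Fin (n + 1)} : i ∈ neg c ↔ c i < 0 := by simp [neg]

theorem mem_posTwo {c : Fin (n + 1) → ℤ} {i : Fin (n + 1)} : i ∈ posTwo c ↔ 2 ≤ c i := by
  simp [posTwo]

/-- The set `(p ∪ a) \ b`, which is the support of `x^{p + c}`, for `c = a - b`. -/
def shift (c : Fin (n + 1) → ℤ) (p : Finset (Fin (n + 1))) : Finset (Fin (n + 1)) :=
  (p ∪ pos c) \ neg c

theorem mem_shift {c : Fin (n + 1) → ℤ} {p : Finset (Fin (n + 1))} {i : Fin (n + 1)} :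
    i ∈ shift c p ↔ (i ∈ p ∨ 0 < c i) ∧ 0 ≤ c i := by
  simp [shift, mem_pos, mem_neg]

theorem shift_mono (c : Fin (n + 1) → ℤ) {p q : Finset (Fin (n + 1))} (h : p ⊆ q) :
    shift c p ⊆ shift c q := fun i hi => by
  rw [mem_shift] at *
  exact ⟨hi.1.imp_left (@h i), hi.2⟩

theorem shift_union (c : Fin (n + 1) → ℤ) (p q : Finset (Fin (n + 1))) :
    shift c (p ∪ q) = shift c p ∪ shift c q := by
  ext i
  simp only [mem_shift, Finset.mem_union]
  tauto

theorem ind_add_nonneg {c : Fin (n + 1) → ℤ} (hc : ∀ i, -1 ≤ c i) {p : Finset (Fin (n + 1))} :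
    0 ≤ ind p + c ↔ neg c ⊆ p := by
  refine forall_congr' fun i => ?_
  have := hc i
  simp only [Pi.zero_apply, Pi.add_apply, ind, mem_neg]
  grind

theorem pos_ind_add {c : Fin (n + 1) → ℤ} (hc : ∀ i, -1 ≤ c i) {p : Finset (Fin (n + 1))}
    (h : neg c ⊆ p) : pos (ind p + c) = shift c p := by
  ext i
  have h1 := hc i
  have h2 := @h i
  simp only [mem_pos, Pi.add_apply, ind, mem_shift, mem_neg] at *
  grind

/-- The point is $p\subseteq ((p\cup a)\setminus b)\cup b$, so the right-hand side inherits being a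
non-face. In the next lemma $p\cap b$ replaces $b$ and is proper when $b\not\subseteq p$. -/
theorem shift_mem_setN (c : Fin (n + 1) → ℤ) {p : Finset (Fin (n + 1))} (hp : p ∉ X)
    (h : shift c p ∈ X) : shift c p ∈ setN X (pos c) (neg c) := by
  refine ⟨h, fun i hi => ?_, ?_, fun h' => hp (X.lower (fun i hi => ?_) h')⟩
  · rw [mem_pos] at hi
    rw [mem_shift]
    exact ⟨Or.inr hi, hi.le⟩
  · ext i
    simp only [Finset.mem_inter, mem_shift, mem_neg, Finset.notMem_empty, iff_false]
    omega
  · simp only [Finset.mem_union, mem_shift, mem_neg] at *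
    by_cases h : c i < 0
    · exact Or.inr h
    · exact Or.inl ⟨Or.inl hi, not_lt.1 h⟩

theorem shift_mem_setN' (c : Fin (n + 1) → ℤ) {p : Finset (Fin (n + 1))} (hp : p ∉ X)
    (h : shift c p ∈ X) (hb : ¬ neg c ⊆ p) : shift c p ∈ setN' X (pos c) (neg c) := by
  refine ⟨shift_mem_setN c hp h, p ∩ neg c, ⟨Finset.inter_subset_right, fun h' => hb fun i hi =>
    (Finset.mem_inter.1 (h' hi)).1⟩, fun h' => hp (X.lower (fun i hi => ?_) h')⟩
  simp only [Finset.mem_union, Finset.mem_inter, mem_shift, mem_neg] at *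
  by_cases h : c i < 0
  · exact Or.inr ⟨hi, h⟩
  · exact Or.inl ⟨Or.inl hi, not_lt.1 h⟩

/-- This makes $f\mapsto f\cup s$ a section of `shift c` on $N_{a-b}$. It is used with $s=b$, with
$s=b'$ a witness for $\widetilde N_{a-b}$, and with $s=b\setminus d_f$. -/
theorem shift_of_mem_setN {c : Fin (n + 1) → ℤ} {f s : Finset (Fin (n + 1))}
    (hf : f ∈ setN X (pos c) (neg c)) (hs : s ⊆ neg c) : shift c (f ∪ s) = f := by
  obtain ⟨-, h1, h2, -⟩ := hf
  ext i
  have h1 := @h1 i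
  have h2 := Finset.ext_iff.1 h2 i
  have hs := @hs i
  simp only [Finset.mem_inter, mem_neg, Finset.notMem_empty, iff_false, not_and, not_lt, mem_pos,
    mem_shift, Finset.mem_union] at *
  grind

theorem IsN1.shift_eq_zero {c : Fin (n + 1) → ℤ} {l : Finset (Fin (n + 1)) → ℂ} (hl : IsN1 X c l)
    {p : Finset (Fin (n + 1))} (hp : p ∉ X) (hb : ¬ neg c ⊆ p) : l (shift c p) = 0 := by
  by_cases h : shift c p ∈ X
  · exact hl.zero _ (shift_mem_setN' c hp h hb)
  · exact hl.zero_off _ h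

theorem IsN1.shift_eq_shift {c : Fin (n + 1) → ℤ} {l : Finset (Fin (n + 1)) → ℂ}
    (hl : IsN1 X c l) {p q : Finset (Fin (n + 1))} (hp : p ∉ X) (hq : q ∉ X)
    (h : shift c (p ∪ q) ∈ X) : l (shift c p) = l (shift c q) := by
  refine hl.eq _ (shift_mem_setN c hp ?_) _ (shift_mem_setN c hq ?_) ?_
  · exact X.lower (shift_mono c Finset.subset_union_left) h
  · exact X.lower (shift_mono c Finset.subset_union_right) h
  · rwa [← shift_union]

/-! ### Homomorphisms described by functions -/

/-- `φ` is the homomorphism `x^p ↦ l((p ∪ a) \ b) x^{p + c}`. -/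
def IsDescribed (X : LowerSet (Finset (Fin (n + 1)))) (c : Fin (n + 1) → ℤ)
    (l : Finset (Fin (n + 1)) → ℂ) (φ : ideal (srGen X) →ₗ[Poly n] SRRing X) : Prop :=
  ∀ p : NonFace X, φ (gen (srGen X) p) = l (shift c p.1) • imono X (ind p.1 + c)

theorem IsHomogHom.isDescribed_iff {c : Fin (n + 1) → ℤ} {l : Finset (Fin (n + 1)) → ℂ}
    {φ : ideal (srGen X) →ₗ[Poly n] SRRing X} (hφ : IsHomogHom X c φ) :
    IsDescribed X c l φ ↔ ∀ (p : NonFace X) (m : Fin (n + 1) →₀ ℕ),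
      (∀ i, (m i : ℤ) = ind p.1 i + c i) →
        φ (gen (srGen X) p) = l ((p.1 ∪ pos c) \ neg c) • mono X m := by
  constructor
  · intro h p m hm
    rw [h p, imono_eq_mono X (e := ind p.1 + c) hm]
    rfl
  · intro h p
    by_cases h0 : 0 ≤ ind p.1 + c
    · obtain ⟨m, hm⟩ := exists_exponent h0
      rw [imono_eq_mono X hm]
      exact h p m hm
    · obtain ⟨a, ha⟩ := hφ.apply_gen p
      rw [ha, imono_of_not_nonneg X h0, smul_zero, smul_zero]

theorem hom_smul_gen {φ : ideal (srGen X) →ₗ[Poly n] SRRing X} {u : ideal (srGen X)}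
    {a : Poly n} {p : NonFace X} (h : (u : Poly n) = a * srGen X p) :
    φ u = a • φ (gen (srGen X) p) := by
  rw [← map_smul]
  exact congrArg φ (Subtype.ext h)

/-- Write $x^e$ as a multiple of the generator belonging to its support; the coefficient depends on
that support only. -/
theorem IsDescribed.apply_ipoly {c e : Fin (n + 1) → ℤ} (hc : ∀ i, -1 ≤ c i)
    {l : Finset (Fin (n + 1)) → ℂ} {φ : ideal (srGen X) →ₗ[Poly n] SRRing X}
    (h : IsDescribed X c l φ) (he : 0 ≤ e) (hX : pos e ∉ X) (a : ℂ) (u : ideal (srGen X))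
    (hu : (u : Poly n) = a • ipoly e) :
    φ u = (a * l (shift c (pos e))) • imono X (e + c) := by
  have h0 : 0 ≤ e - ind (pos e) := fun i => by
    have := he i
    simp only [Pi.zero_apply, Pi.sub_apply, ind, mem_pos] at *
    split_ifs <;> omega
  have : (u : Poly n) = (a • ipoly (e - ind (pos e))) * srGen X ⟨pos e, hX⟩ := by
    rw [hu, srGen_eq_ipoly, smul_mul_assoc, ipoly_mul h0 (ind_nonneg _), sub_add_cancel]
  rw [hom_smul_gen this, h, mul_smul, smul_assoc, smul_comm (ipoly _)]
  congr 2
  by_cases h1 : 0 ≤ ind (pos e) + c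
  · rw [ipoly_smul_imono X h0 h1, ← add_assoc, sub_add_cancel]
  -- Since $c\ge-1$, a negative entry can only occur where $e$ is zero, so replacing $e$ by its
  -- support does not change whether one occurs.
  · rw [imono_of_not_nonneg X h1, smul_zero, imono_of_not_nonneg]
    contrapose! h1
    intro i
    have h1 := h1 i
    have := he i
    have := hc i
    simp only [Pi.zero_apply, Pi.add_apply, ind, mem_pos] at *
    split_ifs <;> omega

theorem exists_describes1 {c : Fin (n + 1) → ℤ} (hc : ∀ i, -1 ≤ c i) {x : SRT1 X}
    (hx : x ∈ t1Deg X c) : ∃ l, Describes1 X c l x := by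
  classical
  obtain ⟨φ, hφ, rfl⟩ := hx
  choose a ha using hφ.apply_gen
  -- Evaluate $\varphi$ on $x^{q\setminus p}x^p=x^{p\setminus q}x^q$ and cancel the nonzero monomial
  -- $x^{p\cup q+c}$. If $b\not\subseteq q$, then $\varphi(x^q)=0$, while the chosen scalar `a q`
  -- carries no information.
  have key (p q : NonFace X) (hp : neg c ⊆ p.1) (h : shift c (p.1 ∪ q.1) ∈ X) :
      a p = if neg c ⊆ q.1 then a q else 0 := by
    have hpq : neg c ⊆ p.1 ∪ q.1 := hp.trans Finset.subset_union_left
    have e1 : ipoly (ind (q.1 \ p.1)) • φ (gen (srGen X) p)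
        = ipoly (ind (p.1 \ q.1)) • φ (gen (srGen X) q) := by
      rw [← map_smul, ← map_smul]
      congr 1
      apply Subtype.ext
      change ipoly _ * srGen X p = ipoly _ * srGen X q
      rw [srGen_eq_ipoly, srGen_eq_ipoly, ipoly_mul (ind_nonneg _) (ind_nonneg _),
        ipoly_mul (ind_nonneg _) (ind_nonneg _), ind_add_ind_sdiff, ind_add_ind_sdiff,
        Finset.union_comm]
    have ne : imono X (ind (p.1 ∪ q.1) + c) ≠ 0 :=
      imono_ne_zero X ((ind_add_nonneg hc).2 hpq) (by rwa [pos_ind_add hc hpq])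
    rw [ha, ha, smul_comm, ipoly_smul_imono X (ind_nonneg _) ((ind_add_nonneg hc).2 hp),
      ← add_assoc, ind_add_ind_sdiff] at e1
    refine smul_left_injective ℂ ne (e1.trans ?_)
    dsimp only
    split_ifs with hq
    · rw [smul_comm, ipoly_smul_imono X (ind_nonneg _) ((ind_add_nonneg hc).2 hq), ← add_assoc,
        ind_add_ind_sdiff, Finset.union_comm]
    · rw [imono_of_not_nonneg X (mt (ind_add_nonneg hc).1 hq), smul_zero, smul_zero, zero_smul]
  -- The lift $f\cup b$ is taken because its coefficient is meaningful: it contains $b$. The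
  -- condition `f ∈ X` enforces the value zero off `X`.
  let l : Finset (Fin (n + 1)) → ℂ := fun f =>
    if h : f ∈ X ∧ f ∪ neg c ∉ X then a ⟨f ∪ neg c, h.2⟩ else 0
  have hl {f} (hf : f ∈ setN X (pos c) (neg c)) : l f = a ⟨f ∪ neg c, hf.2.2.2⟩ :=
    dif_pos ⟨hf.1, hf.2.2.2⟩
  refine ⟨l, ⟨fun f hf => dif_neg fun h => hf h.1, ?_, ?_⟩, φ, hφ, rfl, hφ.isDescribed_iff.1 ?_⟩
  · rintro f ⟨hf, b', hb', hX⟩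
    rw [hl hf, key _ ⟨f ∪ b', hX⟩ Finset.subset_union_right, if_neg]
    · intro h
      refine hb'.2 fun i hi => (Finset.mem_union.1 (h hi)).resolve_left fun hi' => ?_
      exact Finset.notMem_empty i (hf.2.2.1 ▸ Finset.mem_inter.2 ⟨hi', hi⟩)
    · rw [shift_union, shift_of_mem_setN hf subset_rfl, shift_of_mem_setN hf hb'.1,
        Finset.union_self]
      exact hf.1
  · intro f hf g hg h
    rw [hl hf, hl hg, key _ ⟨g ∪ neg c, hg.2.2.2⟩ Finset.subset_union_right,
      if_pos Finset.subset_union_right]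
    rwa [shift_union, shift_of_mem_setN hf subset_rfl, shift_of_mem_setN hg subset_rfl]
  · intro p
    rw [ha]
    by_cases hp : neg c ⊆ p.1
    · by_cases h : shift c p.1 ∈ X
      · have hN := shift_mem_setN c p.2 h
        rw [hl hN, key _ ⟨shift c p.1 ∪ neg c, hN.2.2.2⟩ hp, if_pos Finset.subset_union_right]
        rwa [shift_union, shift_of_mem_setN hN subset_rfl, Finset.union_self]
      · rw [imono_of_pos_notMem X (by rwa [pos_ind_add hc hp]), smul_zero, smul_zero]
    · rw [imono_of_not_nonneg X (mt (ind_add_nonneg hc).1 hp), smul_zero, smul_zero]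

/-! ### The sum of two degrees -/

theorem neg_one_le_add {c₁ c₂ : Fin (n + 1) → ℤ} (h₁ : ∀ i, -1 ≤ c₁ i) (h₂ : ∀ i, -1 ≤ c₂ i)
    (hb : neg c₁ ∩ neg c₂ = ∅) (i : Fin (n + 1)) : -1 ≤ (c₁ + c₂) i := by
  have h := Finset.ext_iff.1 hb i
  have := h₁ i
  have := h₂ i
  simp only [Finset.mem_inter, mem_neg, Finset.notMem_empty, iff_false, Pi.add_apply] at *
  omega

theorem neg_add {c₁ c₂ : Fin (n + 1) → ℤ} (h₁ : ∀ i, -1 ≤ c₁ i) (h₂ : ∀ i, -1 ≤ c₂ i)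
    (hb : neg c₁ ∩ neg c₂ = ∅) :
    neg (c₁ + c₂) = (neg c₁ \ pos c₂) ∪ (neg c₂ \ pos c₁) := by
  ext i
  have h := Finset.ext_iff.1 hb i
  have := h₁ i
  have := h₂ i
  simp only [Finset.mem_inter, mem_neg, mem_pos, Finset.notMem_empty, iff_false, Pi.add_apply,
    Finset.mem_union, Finset.mem_sdiff] at *
  omega

theorem pos_add {c₁ c₂ : Fin (n + 1) → ℤ} (h₁ : ∀ i, -1 ≤ c₁ i) (h₂ : ∀ i, -1 ≤ c₂ i)
    (hb : neg c₁ ∩ neg c₂ = ∅) :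
    pos (c₁ + c₂) = (pos c₁ \ neg c₂) ∪ (pos c₂ \ neg c₁) ∪ (posTwo c₁ ∪ posTwo c₂) := by
  ext i
  have h := Finset.ext_iff.1 hb i
  have := h₁ i
  have := h₂ i
  simp only [Finset.mem_inter, mem_neg, mem_pos, mem_posTwo, Finset.notMem_empty, iff_false,
    Pi.add_apply, Finset.mem_union, Finset.mem_sdiff] at *
  omega

/-! ### The value of the cup product on the relations `R_{p,q}` -/

/-- The coefficient of `ψ(⟨R_{p,q}, t⟩)`, for `t` the monomial lift of `φ`. -/
def halfCoeff (c₁ c₂ : Fin (n + 1) → ℤ) (φ ψ : Finset (Fin (n + 1)) → ℂ)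
    (p q : Finset (Fin (n + 1))) : ℂ :=
  (φ (shift c₁ p) - φ (shift c₁ q)) * ψ (shift c₂ (shift c₁ (p ∪ q)))

/-- The coefficient of the value of the cup product on `R_{p,q}`. -/
def cupCoeff (c₁ c₂ : Fin (n + 1) → ℤ) (φ ψ : Finset (Fin (n + 1)) → ℂ)
    (p q : Finset (Fin (n + 1))) : ℂ :=
  halfCoeff c₁ c₂ φ ψ p q + halfCoeff c₂ c₁ ψ φ p q

theorem halfCoeff_antisymm (c₁ c₂ : Fin (n + 1) → ℤ) (φ ψ : Finset (Fin (n + 1)) → ℂ)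
    (p q : Finset (Fin (n + 1))) : halfCoeff c₁ c₂ φ ψ p q = - halfCoeff c₁ c₂ φ ψ q p := by
  rw [halfCoeff, halfCoeff, Finset.union_comm]
  ring

theorem cupCoeff_antisymm (c₁ c₂ : Fin (n + 1) → ℤ) (φ ψ : Finset (Fin (n + 1)) → ℂ)
    (p q : Finset (Fin (n + 1))) : cupCoeff c₁ c₂ φ ψ p q = - cupCoeff c₁ c₂ φ ψ q p := by
  rw [cupCoeff, cupCoeff, halfCoeff_antisymm, halfCoeff_antisymm c₂]
  ring

variable {c₁ c₂ : Fin (n + 1) → ℤ}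
  {l₁ l₂ : Finset (Fin (n + 1)) → ℂ}

/-- If the first factor is nonzero, then $b^1\subseteq p\cup q$ and the $c_1$-shift of $p\cup q$ is
a non-face. For the second factor to survive, that shift must contain $b^2$, and together the two
inclusions give $b\subseteq p\cup q$. -/
theorem halfCoeff_eq_zero (hc₂ : ∀ i, -1 ≤ c₂ i) (hl₁ : IsN1 X c₁ l₁) (hl₂ : IsN1 X c₂ l₂)
    {p q : Finset (Fin (n + 1))} (hp : p ∉ X) (hq : q ∉ X) (h : ¬ neg (c₁ + c₂) ⊆ p ∪ q) :
    halfCoeff c₁ c₂ l₁ l₂ p q = 0 := by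
  rw [halfCoeff, mul_eq_zero, or_iff_not_imp_left]
  intro hne
  refine hl₂.shift_eq_zero (fun hs => hne (sub_eq_zero.2 (hl₁.shift_eq_shift hp hq hs)))
    fun hb₂ => ?_
  have hb₁ : ¬ neg c₁ ⊆ p ∪ q := fun hb₁ => h fun i hi => by
    have h1 := @hb₁ i
    have h2 := @hb₂ i
    have := hc₂ i
    simp only [mem_neg, Pi.add_apply, mem_shift] at *
    by_cases h3 : c₁ i < 0
    · exact h1 h3
    · exact (h2 (by omega)).1.resolve_right (by omega)
  rw [hl₁.shift_eq_zero hp fun hb => hb₁ (hb.trans Finset.subset_union_left),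
    hl₁.shift_eq_zero hq fun hb => hb₁ (hb.trans Finset.subset_union_right), sub_zero] at hne
  exact hne rfl

/-- If $b^1\not\subseteq p$, the right-hand monomial may be nonzero, but its coefficient vanishes
because `l₁` is zero on $\widetilde N$ and off `X`. -/
theorem ipoly_mul_smul_ipoly (hc₁ : ∀ i, -1 ≤ c₁ i) (hl₁ : IsN1 X c₁ l₁)
    {p : Finset (Fin (n + 1))} (hp : p ∉ X) (q : Finset (Fin (n + 1))) :
    ipoly (ind (q \ p)) * (l₁ (shift c₁ p) • ipoly (ind p + c₁))
      = l₁ (shift c₁ p) • ipoly (ind (p ∪ q) + c₁) := by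
  by_cases hb : neg c₁ ⊆ p
  · rw [mul_smul_comm, ipoly_mul (ind_nonneg _) ((ind_add_nonneg hc₁).2 hb), ← add_assoc,
      ind_add_ind_sdiff]
  · rw [hl₁.shift_eq_zero hp hb, zero_smul, zero_smul, mul_zero]

/-- The pairing is the difference of the two `l₁`-values times $x^{p\cup q+c_1}$. A nonzero
difference forces the support of this monomial out of `X`, so `IsDescribed.apply_ipoly` applies to
$\psi$. -/
theorem IsDescribed.apply_pairing_taylorRel (hc₁ : ∀ i, -1 ≤ c₁ i) (hc₂ : ∀ i, -1 ≤ c₂ i)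
    (hl₁ : IsN1 X c₁ l₁) {φ ψ : ideal (srGen X) →ₗ[Poly n] SRRing X}
    (hψ : IsDescribed X c₂ l₂ ψ) (hφ : IsLift (srGen X) φ fun p =>
      l₁ (shift c₁ p.1) • ipoly (ind p.1 + c₁)) (p q : NonFace X) :
    ψ (hφ.pairing (taylorRel X p q))
      = halfCoeff c₁ c₂ l₁ l₂ p q • imono X (ind (p.1 ∪ q.1) + (c₁ + c₂)) := by
  classical
  have hu : (hφ.pairing (taylorRel X p q) : Poly n)
      = (l₁ (shift c₁ p.1) - l₁ (shift c₁ q.1)) • ipoly (ind (p.1 ∪ q.1) + c₁) := by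
    change Fintype.linearCombination _ _ (taylorRel X p q : NonFace X → Poly n) = _
    rw [coe_taylorRel, map_sub, Fintype.linearCombination_apply_single,
      Fintype.linearCombination_apply_single, smul_eq_mul, smul_eq_mul,
      ipoly_mul_smul_ipoly hc₁ hl₁ p.2, ipoly_mul_smul_ipoly hc₁ hl₁ q.2, Finset.union_comm q.1,
      sub_smul]
  by_cases h : l₁ (shift c₁ p.1) - l₁ (shift c₁ q.1) = 0
  · rw [halfCoeff, h, zero_mul, zero_smul]
    rw [h, zero_smul] at hu
    rw [show hφ.pairing (taylorRel X p q) = 0 from Subtype.ext hu, map_zero]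
  · have hb : neg c₁ ⊆ p.1 ∪ q.1 := by
      contrapose! h
      rw [hl₁.shift_eq_zero p.2 fun hb => h (hb.trans Finset.subset_union_left),
        hl₁.shift_eq_zero q.2 fun hb => h (hb.trans Finset.subset_union_right), sub_zero]
    have hs : shift c₁ (p.1 ∪ q.1) ∉ X := fun hs => h <| sub_eq_zero.2 <|
      hl₁.shift_eq_shift p.2 q.2 hs
    rw [← pos_ind_add hc₁ hb] at hs
    rw [hψ.apply_ipoly hc₂ ((ind_add_nonneg hc₁).2 hb) hs _ _ hu, pos_ind_add hc₁ hb, add_assoc,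
      halfCoeff]

/-! ### From coefficients on the relations to functions on pairs of faces -/

/-- `h` maps `R_{p,q}` to `μ(p,q) x^{p ∪ q + c}`, where `μ(p,q)` vanishes if `p ∪ q + c` has a
negative entry. -/
structure IsRelCoeff (c : Fin (n + 1) → ℤ) (h : RelHom (srGen X))
    (μ : Finset (Fin (n + 1)) → Finset (Fin (n + 1)) → ℂ) : Prop where
  apply_taylorRel : ∀ p q : NonFace X, h (Submodule.Quotient.mk (taylorRel X p q))
    = μ p.1 q.1 • imono X (ind (p.1 ∪ q.1) + c)
  antisymm : ∀ p q, μ p q = - μ q p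
  eq_zero : ∀ p q : NonFace X, ¬ neg c ⊆ p.1 ∪ q.1 → μ p.1 q.1 = 0

theorem exists_relHom (hc₁ : ∀ i, -1 ≤ c₁ i) (hc₂ : ∀ i, -1 ≤ c₂ i) {x y : SRT1 X}
    (hx : Describes1 X c₁ l₁ x) (hy : Describes1 X c₂ l₂ y) :
    ∃ h : RelHom (srGen X), IsHomogRelHom X (c₁ + c₂) h ∧ cup ℂ x y = Submodule.Quotient.mk h ∧
      IsRelCoeff (c₁ + c₂) h (cupCoeff c₁ c₂ l₁ l₂) := by
  obtain ⟨hl₁, φ, hφ, rfl, hφ'⟩ := hx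
  obtain ⟨hl₂, ψ, hψ, rfl, hψ'⟩ := hy
  rw [← hφ.isDescribed_iff] at hφ'
  rw [← hψ.isDescribed_iff] at hψ'
  have ht : IsLift (srGen X) φ fun p => l₁ (shift c₁ p.1) • ipoly (ind p.1 + c₁) :=
    fun p => by rw [hφ' p]; rfl
  have ht' : IsLift (srGen X) ψ fun p => l₂ (shift c₂ p.1) • ipoly (ind p.1 + c₂) :=
    fun p => by rw [hψ' p]; rfl
  refine ⟨_, isHomogRelHom_cupHom hφ hψ ht ht' (fun p => mem_polyDeg.2 ⟨_, rfl⟩)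
    (fun p => mem_polyDeg.2 ⟨_, rfl⟩), cup_mk ℂ ht ht', ⟨fun p q => ?_,
    cupCoeff_antisymm c₁ c₂ l₁ l₂, fun p q h => ?_⟩⟩
  · change ψ (ht.pairing _) + φ (ht'.pairing _) = _
    rw [hψ'.apply_pairing_taylorRel hc₁ hc₂ hl₁, hφ'.apply_pairing_taylorRel hc₂ hc₁ hl₂,
      add_comm c₂ c₁, ← add_smul, cupCoeff]
  · rw [cupCoeff, halfCoeff_eq_zero hc₂ hl₁ hl₂ p.2 q.2 h, halfCoeff_eq_zero hc₁ hl₂ hl₁ p.2 q.2,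
      add_zero]
    rwa [add_comm c₂]

namespace IsRelCoeff

variable {c : Fin (n + 1) → ℤ} {h : RelHom (srGen X)}
  {μ : Finset (Fin (n + 1)) → Finset (Fin (n + 1)) → ℂ}

theorem apply_smul_taylorRel (hc : ∀ i, -1 ≤ c i) (hμ : IsRelCoeff c h μ) (p q : NonFace X)
    {e : Fin (n + 1) → ℤ} (he : 0 ≤ e) :
    h (Submodule.Quotient.mk (ipoly e • taylorRel X p q))
      = μ p.1 q.1 • imono X (e + (ind (p.1 ∪ q.1) + c)) := by
  rw [Submodule.Quotient.mk_smul, map_smul, hμ.apply_taylorRel, smul_comm]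
  by_cases hb : neg c ⊆ p.1 ∪ q.1
  · rw [ipoly_smul_imono X he ((ind_add_nonneg hc).2 hb)]
  · rw [hμ.eq_zero p q hb, zero_smul, zero_smul]

open Classical in
theorem coe_ipoly_smul_taylorRel {L : Finset (Fin (n + 1))} {p q : NonFace X}
    (hp : p.1 ⊆ L) (hq : q.1 ⊆ L) :
    ((ipoly (ind (L \ (p.1 ∪ q.1))) • taylorRel X p q : Rel (srGen X)) : NonFace X → Poly n)
      = Pi.single p (ipoly (ind (L \ p.1))) - Pi.single q (ipoly (ind (L \ q.1))) := by
  rw [Submodule.coe_smul, coe_taylorRel, smul_sub, ← Pi.single_smul, ← Pi.single_smul, smul_eq_mul,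
    smul_eq_mul, ipoly_mul (ind_nonneg _) (ind_nonneg _), ipoly_mul (ind_nonneg _) (ind_nonneg _)]
  congr 3 <;>
  · ext i
    have hp := @hp i
    have hq := @hq i
    simp only [ind, Pi.add_apply, Finset.mem_sdiff, Finset.mem_union]
    grind

/-- Apply `h` to the syzygy among $R_{p,q}$, $R_{p,r}$, $R_{q,r}$ in degree $L=p\cup q\cup r$ and
cancel $x^{L+c}\ne0$. If $b\not\subseteq L$, all three coefficients vanish separately. -/
theorem cocycle (hc : ∀ i, -1 ≤ c i) (hμ : IsRelCoeff c h μ) (p q r : NonFace X)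
    (hX : shift c (p.1 ∪ q.1 ∪ r.1) ∈ X) : μ p.1 q.1 - μ p.1 r.1 + μ q.1 r.1 = 0 := by
  classical
  set L := p.1 ∪ q.1 ∪ r.1 with hL
  have hp : p.1 ⊆ L := fun i hi => by simp [hL, hi]
  have hq : q.1 ⊆ L := fun i hi => by simp [hL, hi]
  have hr : r.1 ⊆ L := fun i hi => by simp [hL, hi]
  by_cases hb : neg c ⊆ L
  · have key {s t : NonFace X} (hs : s.1 ⊆ L) (ht : t.1 ⊆ L) :
        h (Submodule.Quotient.mk (ipoly (ind (L \ (s.1 ∪ t.1))) • taylorRel X s t))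
          = μ s.1 t.1 • imono X (ind L + c) := by
      rw [hμ.apply_smul_taylorRel hc s t (ind_nonneg _), ← add_assoc, ind_add_ind_sdiff,
        Finset.union_eq_right.2 (Finset.union_subset hs ht)]
    have e : ipoly (ind (L \ (p.1 ∪ q.1))) • taylorRel X p q
        - ipoly (ind (L \ (p.1 ∪ r.1))) • taylorRel X p r
        + ipoly (ind (L \ (q.1 ∪ r.1))) • taylorRel X q r = 0 := by
      apply Subtype.ext
      rw [Submodule.coe_add, Submodule.coe_sub, coe_ipoly_smul_taylorRel hp hq,
        coe_ipoly_smul_taylorRel hp hr, coe_ipoly_smul_taylorRel hq hr, Submodule.coe_zero]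
      abel
    have e' := congrArg (fun s => h (Submodule.Quotient.mk s)) e
    simp only [Submodule.Quotient.mk_add, Submodule.Quotient.mk_sub, Submodule.Quotient.mk_zero,
      map_add, map_sub, map_zero] at e'
    rw [key hp hq, key hp hr, key hq hr, ← sub_smul, ← add_smul] at e'
    refine (smul_eq_zero.1 e').resolve_right (imono_ne_zero X ((ind_add_nonneg hc).2 hb) ?_)
    rwa [pos_ind_add hc hb]
  · rw [hμ.eq_zero p q fun h => hb (h.trans (Finset.union_subset hp hq)),
      hμ.eq_zero p r fun h => hb (h.trans (Finset.union_subset hp hr)),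
      hμ.eq_zero q r fun h => hb (h.trans (Finset.union_subset hq hr)), sub_zero, add_zero]

/-- Koszul relations force the vanishing of coefficients. -/
theorem eq_zero_of_union_inter_mem (hc : ∀ i, -1 ≤ c i) (hμ : IsRelCoeff c h μ) (p q : NonFace X)
    (hX : shift c (p.1 ∪ q.1) ∪ (p.1 ∩ q.1) ∈ X) : μ p.1 q.1 = 0 := by
  classical
  by_cases hb : neg c ⊆ p.1 ∪ q.1
  · have hk : ipoly (ind (p.1 ∩ q.1)) • taylorRel X p q ∈ koszul (srGen X) := by
      refine Submodule.subset_span ⟨Pi.single p 1, Pi.single q 1, ?_⟩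
      rw [Fintype.linearCombination_apply_single, Fintype.linearCombination_apply_single,
        one_smul, one_smul, Submodule.coe_smul, coe_taylorRel, smul_sub, ← Pi.single_smul,
        ← Pi.single_smul, ← Pi.single_smul, ← Pi.single_smul, smul_eq_mul, smul_eq_mul,
        smul_eq_mul, smul_eq_mul, mul_one, mul_one, srGen_eq_ipoly, srGen_eq_ipoly,
        ipoly_mul (ind_nonneg _) (ind_nonneg _), ipoly_mul (ind_nonneg _) (ind_nonneg _)]
      congr 3 <;>
      · ext i
        simp only [ind, Pi.add_apply, Finset.mem_sdiff, Finset.mem_inter]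
        grind
    have e := hμ.apply_smul_taylorRel hc p q (ind_nonneg (p.1 ∩ q.1))
    rw [(Submodule.Quotient.mk_eq_zero _).2 hk, map_zero] at e
    have h0 := (ind_add_nonneg hc).2 hb
    refine (smul_eq_zero.1 e.symm).resolve_right
      (imono_ne_zero X (add_nonneg (ind_nonneg _) h0) ?_)
    rw [← pos_ind_add hc hb] at hX
    convert hX using 1
    ext i
    have hi : 0 ≤ (ind (p.1 ∪ q.1) + c) i := h0 i
    rw [Finset.mem_union, mem_pos, mem_pos, Pi.add_apply]
    generalize (ind (p.1 ∪ q.1) + c) i = z at hi ⊢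
    by_cases h : i ∈ p.1 ∩ q.1
    · simp only [ind, h, if_true, or_true, iff_true]; omega
    · simp only [ind, h, if_false, or_false, zero_add]
  · exact hμ.eq_zero p q hb

/-- Let $r$ be the shift of $p\cup q$ together with $p\cap q$. If $r\in X$, the Koszul relation
$x^{p\cap q}R_{p,q}$ forces the vanishing. If not, $r$ serves as a third non-face in the cocycle
identity. -/
theorem eq_zero_of_not_subset (hc : ∀ i, -1 ≤ c i) (hμ : IsRelCoeff c h μ) (p q : NonFace X)
    (hp : ¬ neg c ⊆ p.1) (hq : ¬ neg c ⊆ q.1) (hX : shift c (p.1 ∪ q.1) ∈ X) :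
    μ p.1 q.1 = 0 := by
  by_cases hr : shift c (p.1 ∪ q.1) ∪ (p.1 ∩ q.1) ∈ X
  · exact hμ.eq_zero_of_union_inter_mem hc p q hr
  -- Inside $b$ the set $r$ has only elements of $p\cap q$, so $p\cup r$ and $q\cup r$ still miss
  -- part of $b$, and their coefficients vanish by degree.
  · have hz (s : NonFace X) (hs : ¬ neg c ⊆ s.1) (h' : p.1 ∩ q.1 ⊆ s.1) :
        μ s.1 (shift c (p.1 ∪ q.1) ∪ (p.1 ∩ q.1)) = 0 := by
      refine hμ.eq_zero s ⟨_, hr⟩ fun h => hs fun i hi => ?_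
      have h1 := h hi
      have h2 := @h' i
      simp only [Finset.mem_union, mem_shift, mem_neg] at *
      rcases h1 with h1 | h1 | h1
      · exact h1
      · omega
      · exact h2 h1
    have := hμ.cocycle hc p q ⟨_, hr⟩ (by
      convert hX using 1
      ext i
      simp only [Finset.mem_union, mem_shift, Finset.mem_inter]
      tauto)
    simpa [hz p hp Finset.inter_subset_left, hz q hq Finset.inter_subset_right] using this

/-- Normalisation by a section `s` of `shift c`: a coboundary is subtracted so that the coefficients
depend on the shifted sets only. The hypothesis `hsb` says that `s f` misses part of $b$ whenever
some non-face above `f` does. -/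
theorem describes2 (hc : ∀ i, -1 ≤ c i) (hh : IsHomogRelHom X c h) (hμ : IsRelCoeff c h μ)
    {s : Finset (Fin (n + 1)) → Finset (Fin (n + 1))}
    (hs : ∀ f ∈ setN X (pos c) (neg c), s f ∉ X)
    (hsf : ∀ f ∈ setN X (pos c) (neg c), shift c (s f) = f)
    (hsb : ∀ p : NonFace X, shift c p.1 ∈ X → ¬ neg c ⊆ p.1 → ¬ neg c ⊆ s (shift c p.1))
    {l : Finset (Fin (n + 1)) → Finset (Fin (n + 1)) → ℂ}
    (hl : ∀ f ∈ setN X (pos c) (neg c), ∀ g ∈ setN X (pos c) (neg c), l f g = μ (s f) (s g)) :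
    Describes2 X c l (Submodule.Quotient.mk h) := by
  classical
  have hN' {f} (hf : f ∈ setN' X (pos c) (neg c)) : ¬ neg c ⊆ s f := by
    obtain ⟨hf, b', hb', hX⟩ := hf
    have e := shift_of_mem_setN hf hb'.1
    rw [← e]
    refine hsb ⟨_, hX⟩ (by rw [e]; exact hf.1) fun h => hb'.2 fun i hi => ?_
    refine (Finset.mem_union.1 (h hi)).resolve_left fun hi' => ?_
    exact Finset.notMem_empty i (hf.2.2.1 ▸ Finset.mem_inter.2 ⟨hi', hi⟩)
  refine ⟨⟨fun f hf g hg _ => ?_, fun f hf g hg hX => ?_, fun f hf g hg k hk hX => ?_⟩, ?_⟩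
  · rw [hl f hf g hg, hl g hg f hf, hμ.antisymm]
  · rw [hl f hf.1 g hg.1]
    refine hμ.eq_zero_of_not_subset hc ⟨s f, hs f hf.1⟩ ⟨s g, hs g hg.1⟩ (hN' hf) (hN' hg) ?_
    rwa [shift_union, hsf f hf.1, hsf g hg.1]
  · rw [hl f hf g hg, hl f hf k hk, hl g hg k hk]
    refine hμ.cocycle hc ⟨s f, hs f hf⟩ ⟨s g, hs g hg⟩ ⟨s k, hs k hk⟩ ?_
    rwa [shift_union, shift_union, hsf f hf, hsf g hg, hsf k hk]
  -- The coboundary compares `p` with the chosen representative of its shift. It is set to zero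
  -- where $x^{p+c}$ is zero anyway.
  let κ : NonFace X → ℂ := fun p =>
    if neg c ⊆ p.1 ∧ shift c p.1 ∈ X then μ p.1 (s (shift c p.1)) else 0
  let u : (NonFace X → Poly n) →ₗ[Poly n] SRRing X :=
    Fintype.linearCombination (Poly n) fun p => κ p • imono X (ind p.1 + c)
  have hu (r : Rel (srGen X)) : restrictHom (srGen X) u (Submodule.Quotient.mk r) =
    ∑ p, (r : NonFace X → Poly n) p • κ p • imono X (ind p.1 + c) := rfl
  have hu' (p q : NonFace X) : restrictHom (srGen X) u (Submodule.Quotient.mk (taylorRel X p q))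
      = (κ p - κ q) • imono X (ind (p.1 ∪ q.1) + c) := by
    have key (p q : NonFace X) : ipoly (ind (q.1 \ p.1)) • κ p • imono X (ind p.1 + c)
        = κ p • imono X (ind (p.1 ∪ q.1) + c) := by
      by_cases hb : neg c ⊆ p.1
      · rw [smul_comm, ipoly_smul_imono X (ind_nonneg _) ((ind_add_nonneg hc).2 hb), ← add_assoc,
          ind_add_ind_sdiff]
      · simp [κ, hb]
    change u (taylorRel X p q : NonFace X → Poly n) = _
    rw [coe_taylorRel, map_sub, Fintype.linearCombination_apply_single,
      Fintype.linearCombination_apply_single, key, key, Finset.union_comm q.1, sub_smul]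
  refine ⟨h - restrictHom (srGen X) u, fun e r hr => ?_, ?_, fun p q m hm => ?_⟩
  · refine sub_mem (hh e r hr) ?_
    rw [hu]
    refine sum_mem fun p _ => ?_
    obtain ⟨a, ha⟩ := mem_polyDeg.1 (hr p)
    rw [ha, smul_assoc]
    refine Submodule.smul_mem _ _ ?_
    rw [smul_comm]
    refine Submodule.smul_mem _ _ ⟨ipoly (e - ind p.1) * ipoly (ind p.1 + c), ?_, ?_⟩
    · have := mul_mem_polyDeg (mem_polyDeg.2 ⟨1, (one_smul ℂ (ipoly (e - ind p.1))).symm⟩)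
        (mem_polyDeg.2 ⟨1, (one_smul ℂ (ipoly (ind p.1 + c))).symm⟩)
      rwa [← add_assoc, sub_add_cancel] at this
    · simp [imono, Algebra.smul_def]
  · rw [Submodule.Quotient.eq, sub_sub_cancel]
    exact ⟨u, rfl⟩
  · rw [LinearMap.sub_apply, hu', hμ.apply_taylorRel, ← sub_smul,
      ← imono_eq_mono X (e := ind (p.1 ∪ q.1) + c) hm]
    have hb : neg c ⊆ p.1 ∪ q.1 := (ind_add_nonneg hc).1 fun i => by
      rw [Pi.add_apply, ← hm i]; simp
    by_cases hX : shift c (p.1 ∪ q.1) ∈ X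
    · have hp : shift c p.1 ∈ X := X.lower (shift_mono c Finset.subset_union_left) hX
      have hq : shift c q.1 ∈ X := X.lower (shift_mono c Finset.subset_union_right) hX
      have hpN := shift_mem_setN c p.2 hp
      have hqN := shift_mem_setN c q.2 hq
      have hκ (t : NonFace X) (ht : shift c t.1 ∈ X) : κ t = μ t.1 (s (shift c t.1)) := by
        have htN := shift_mem_setN c t.2 ht
        by_cases hb : neg c ⊆ t.1
        · exact if_pos ⟨hb, ht⟩
        -- Here `κ t` is zero by definition, and `hsb` makes the coefficient it should equal vanish
        -- as well.
        · refine (if_neg fun h => hb h.1).trans (Eq.symm ?_)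
          refine hμ.eq_zero_of_not_subset hc t ⟨_, hs _ htN⟩ hb (hsb t ht hb) ?_
          rwa [shift_union, hsf _ htN, Finset.union_self]
      -- With $f,g$ the shifts of $p,q$, the triples $(p,q,s(g))$ and $(p,s(f),s(g))$ exchange first
      -- $q$ and then $p$ for its representative.
      have e1 := hμ.cocycle hc p q ⟨_, hs _ hqN⟩ (by
        rwa [shift_union, hsf _ hqN, shift_union, Finset.union_assoc, Finset.union_self,
          ← shift_union])
      have e2 := hμ.cocycle hc p ⟨_, hs _ hpN⟩ ⟨_, hs _ hqN⟩ (by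
        rwa [shift_union, shift_union, hsf _ hqN, hsf _ hpN, Finset.union_self,
          ← shift_union])
      change _ = l (shift c p.1) (shift c q.1) • _
      congr 1
      rw [hl _ hpN _ hqN, hκ p hp, hκ q hq]
      linear_combination e1 - e2
    · rw [imono_of_pos_notMem X (by rwa [pos_ind_add hc hb]), smul_zero, smul_zero]

end IsRelCoeff

/-! ### Comparison with the formula for the cup product -/

/-- An element of $a^1$ lies in $a\subseteq f$ unless it is cancelled by $b^2$; in that case it is
not in $b$, hence not in $d$, and it appears in $b^2\setminus d$. After both shifts nothing of
$b\setminus d$ or $b\setminus e$ remains. -/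
theorem cupValue_eq_cupCoeff (hc₁ : ∀ i, -1 ≤ c₁ i) (hc₂ : ∀ i, -1 ≤ c₂ i)
    (hb : neg c₁ ∩ neg c₂ = ∅) {f g d e : Finset (Fin (n + 1))}
    (hf : f ∈ setN X (pos (c₁ + c₂)) (neg (c₁ + c₂)))
    (hg : g ∈ setN X (pos (c₁ + c₂)) (neg (c₁ + c₂)))
    (hd : d ⊆ neg (c₁ + c₂)) (he : e ⊆ neg (c₁ + c₂)) (φ ψ : Finset (Fin (n + 1)) → ℂ) :
    cupValue (pos c₁) (neg c₁) (pos c₂) (neg c₂) d e f g φ ψ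
      = cupCoeff c₁ c₂ φ ψ (f ∪ (neg (c₁ + c₂) \ d)) (g ∪ (neg (c₁ + c₂) \ e)) := by
  have h1 {c₁ c₂ : Fin (n + 1) → ℤ} (hc₁ : ∀ i, -1 ≤ c₁ i) (hc₂ : ∀ i, -1 ≤ c₂ i)
      (hb : neg c₁ ∩ neg c₂ = ∅) {f d : Finset (Fin (n + 1))}
      (hf : f ∈ setN X (pos (c₁ + c₂)) (neg (c₁ + c₂))) (hd : d ⊆ neg (c₁ + c₂)) :
      shift c₁ (f ∪ (neg (c₁ + c₂) \ d)) = (f \ neg c₁) ∪ (neg c₂ \ d) := by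
    ext i
    have h1 := hc₁ i
    have h2 := hc₂ i
    have h3 := Finset.ext_iff.1 hb i
    have h4 := @hf.2.1 i
    have h5 := Finset.ext_iff.1 hf.2.2.1 i
    have h6 := @hd i
    simp only [Finset.mem_inter, mem_neg, mem_pos, Finset.notMem_empty, iff_false, Pi.add_apply,
      Finset.mem_union, Finset.mem_sdiff, mem_shift] at *
    grind
  have h2 {c₁ c₂ : Fin (n + 1) → ℤ} (hc₁ : ∀ i, -1 ≤ c₁ i) (hc₂ : ∀ i, -1 ≤ c₂ i)
      (hb : neg c₁ ∩ neg c₂ = ∅) {f g d e : Finset (Fin (n + 1))}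
      (hf : f ∈ setN X (pos (c₁ + c₂)) (neg (c₁ + c₂)))
      (hg : g ∈ setN X (pos (c₁ + c₂)) (neg (c₁ + c₂))) :
      shift c₂ (shift c₁ (f ∪ (neg (c₁ + c₂) \ d) ∪ (g ∪ (neg (c₁ + c₂) \ e))))
        = (f ∪ g ∪ pos c₂) \ neg c₂ := by
    ext i
    have h1 := hc₁ i
    have h2 := hc₂ i
    have h3 := Finset.ext_iff.1 hb i
    have h4 := @hf.2.1 i
    have h5 := Finset.ext_iff.1 hf.2.2.1 i
    have h6 := Finset.ext_iff.1 hg.2.2.1 i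
    simp only [Finset.mem_inter, mem_neg, mem_pos, Finset.notMem_empty, iff_false, Pi.add_apply,
      Finset.mem_union, Finset.mem_sdiff, mem_shift] at *
    grind
  rw [cupValue, cupCoeff, halfCoeff, halfCoeff, h1 hc₁ hc₂ hb hf hd, h1 hc₁ hc₂ hb hg he,
    h2 hc₁ hc₂ hb hf hg]
  rw [add_comm c₁ c₂] at hf hg hd he ⊢
  rw [Finset.inter_comm] at hb
  rw [h1 hc₂ hc₁ hb hf hd, h1 hc₂ hc₁ hb hg he, h2 hc₂ hc₁ hb hf hg]

/-- Maximality of $d_f$ enters only through the condition `hsb` of `IsRelCoeff.describes2`. -/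
theorem describes2_cup (hc₁ : ∀ i, -1 ≤ c₁ i) (hc₂ : ∀ i, -1 ≤ c₂ i)
    (hb : neg c₁ ∩ neg c₂ = ∅) {d : Finset (Fin (n + 1)) → Finset (Fin (n + 1))}
    (hd : IsMaxChoice X (pos (c₁ + c₂)) (neg (c₁ + c₂)) d) {x y : SRT1 X}
    (hx : Describes1 X c₁ l₁ x) (hy : Describes1 X c₂ l₂ y) :
    Describes2 X (c₁ + c₂) (fun f g => cupValue (pos c₁) (neg c₁) (pos c₂) (neg c₂) (d f) (d g)
      f g l₁ l₂) (cup ℂ x y) := by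
  obtain ⟨h, hh, e, hμ⟩ := exists_relHom hc₁ hc₂ hx hy
  rw [e]
  refine hμ.describes2 (neg_one_le_add hc₁ hc₂ hb) hh
    (s := fun f => f ∪ (neg (c₁ + c₂) \ d f)) (fun f hf => (hd f hf).prop.2)
    (fun f hf => shift_of_mem_setN hf Finset.sdiff_subset) (fun p hp hpb hsb => ?_)
    fun f hf g hg => cupValue_eq_cupCoeff hc₁ hc₂ hb hf hg (hd f hf).prop.1 (hd g hg).prop.1 l₁ l₂
  set c := c₁ + c₂
  have hN := shift_mem_setN c p.2 hp
  have hdis : ∀ i ∈ neg c, i ∉ shift c p.1 := fun i hi hi' => by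
    rw [mem_neg] at hi
    rw [mem_shift] at hi'
    omega
  refine hpb fun i hi => by_contra fun hip => ?_
  -- The set $b\setminus p$ is admissible for the shift of $p$. If the representative contained $b$,
  -- then $d$ would be empty, hence contained in $b\setminus p$, and maximality would give
  -- $b\setminus p\subseteq d$, contradicting $b\not\subseteq p$.
  have hle : neg c \ p.1 ≤ d (shift c p.1) := by
    refine (hd _ hN).le_of_ge ⟨Finset.sdiff_subset, fun h' => p.2 (X.lower (fun j hj => ?_) h')⟩
      fun j hj => ?_
    · by_cases hj' : j ∈ neg c
      · exact Finset.mem_union_right _ (by simp [hj, hj'])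
      · rw [mem_neg] at hj'
        exact Finset.mem_union_left _ (mem_shift.2 ⟨Or.inl hj, not_lt.1 hj'⟩)
    · have hj' := (hd _ hN).prop.1 hj
      have := (Finset.mem_union.1 (hsb hj')).resolve_left (hdis j hj')
      exact absurd hj (Finset.mem_sdiff.1 this).2
  have := (Finset.mem_union.1 (hsb hi)).resolve_left (hdis i hi)
  exact (Finset.mem_sdiff.1 this).2 (hle (Finset.mem_sdiff.2 ⟨hi, hip⟩))

end CupProduct

end StanleyReisner

theorem proposition6p1 (n : ℕ) (X : LowerSet (Finset (Fin (n + 1)))) (c₁ c₂ : Fin (n + 1) → ℤ) :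
    (∀ x ∈ StanleyReisner.t1Deg X c₁, ∀ y ∈ StanleyReisner.t1Deg X c₂,
      Cotangent.cup ℂ x y ∈ StanleyReisner.t2Deg X (c₁ + c₂)) ∧
    (((StanleyReisner.neg c₁ ∩ StanleyReisner.neg c₂).Nonempty ∨
        ∃ i, c₁ i < -1 ∨ c₂ i < -1) →
      ∀ x ∈ StanleyReisner.t1Deg X c₁, ∀ y ∈ StanleyReisner.t1Deg X c₂,
        Cotangent.cup ℂ x y = 0) ∧
    ((∀ i, -1 ≤ c₁ i) → (∀ i, -1 ≤ c₂ i) →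
      StanleyReisner.neg c₁ ∩ StanleyReisner.neg c₂ = ∅ →
      ((∀ i, -1 ≤ (c₁ + c₂) i) ∧
        StanleyReisner.neg (c₁ + c₂) =
          (StanleyReisner.neg c₁ \ StanleyReisner.pos c₂) ∪
            (StanleyReisner.neg c₂ \ StanleyReisner.pos c₁) ∧
        StanleyReisner.pos (c₁ + c₂) =
          (StanleyReisner.pos c₁ \ StanleyReisner.neg c₂) ∪
            (StanleyReisner.pos c₂ \ StanleyReisner.neg c₁) ∪
            (StanleyReisner.posTwo c₁ ∪ StanleyReisner.posTwo c₂)) ∧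
      (∀ x ∈ StanleyReisner.t1Deg X c₁, ∃ φ, StanleyReisner.Describes1 X c₁ φ x) ∧
      (∀ y ∈ StanleyReisner.t1Deg X c₂, ∃ ψ, StanleyReisner.Describes1 X c₂ ψ y) ∧
      ∀ d : Finset (Fin (n + 1)) → Finset (Fin (n + 1)),
        StanleyReisner.IsMaxChoice X (StanleyReisner.pos (c₁ + c₂))
          (StanleyReisner.neg (c₁ + c₂)) d →
        ∀ (x y : StanleyReisner.SRT1 X) (φ ψ : Finset (Fin (n + 1)) → ℂ),
          StanleyReisner.Describes1 X c₁ φ x → StanleyReisner.Describes1 X c₂ ψ y →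
          StanleyReisner.Describes2 X (c₁ + c₂)
            (fun f g => StanleyReisner.cupValue
              (StanleyReisner.pos c₁) (StanleyReisner.neg c₁)
              (StanleyReisner.pos c₂) (StanleyReisner.neg c₂) (d f) (d g) f g φ ψ)
            (Cotangent.cup ℂ x y)) := by
  refine ⟨fun x hx y hy => StanleyReisner.cup_mem_t2Deg hx hy, ?_, fun hc₁ hc₂ hb =>
    ⟨⟨StanleyReisner.neg_one_le_add hc₁ hc₂ hb, StanleyReisner.neg_add hc₁ hc₂ hb,
      StanleyReisner.pos_add hc₁ hc₂ hb⟩,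
    fun x hx => StanleyReisner.exists_describes1 hc₁ hx,
    fun y hy => StanleyReisner.exists_describes1 hc₂ hy,
    fun d hd x y φ ψ hx hy => StanleyReisner.describes2_cup hc₁ hc₂ hb hd hx hy⟩⟩
  rintro (h | ⟨i, h | h⟩) x hx y hy
  · exact StanleyReisner.cup_eq_zero_of_neg_inter h hx hy
  · exact StanleyReisner.cup_eq_zero_of_lt hx h y
  · rw [StanleyReisner.cup_comm]
    exact StanleyReisner.cup_eq_zero_of_lt hy h x
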